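/- **Setting.** Let $(\mathcal M,g)$ be a compact connected smooth Riemannian manifold (without boundary) of dimension $m\ge 1$, with geodesic distance $d_g$ and volume measure $d\mathrm{Vol}$. Let $\nu=\rho\,d\mathrm{Vol}$ be a probability measure whose density $\rho$ is smooth and satisfies $1/\beta\le\rho\le\beta$ and $|\rho(x)-\rho(y)|\le L_1 d_g(x,y)$ for all $x,y\in\mathcal M$. Let $x_1,\dots,x_n$ be an i.i.d. sample from $\nu$, with empirical measure $\nu_n=\frac1n\sum_i\delta_{x_i}$. For a measurable $T:\mathcal M\to\mathcal M$ with $T_\#\nu=\nu_n$ put $d_\infty=d_\infty(T)=\operatorname{ess\,sup}_{x\in\mathcal M} d_g(x,T(x))$. Let $\eta=\frac{1}{\omega_m}\mathbf 1_{[0,1]}$, where $\omega_m$ is the volume of the unit ball of $\mathbb R^m$. For a distance function $d$ on the sample (nonnegative, symmetric, zero on the diagonal) and a bandwidth $h>0$ let $$w_{ij}=\frac{1}{nh^m}\,\eta\!\left(\frac{d(x_i,x_j)}{h}\right),\qquad m_i=\sum_j w_{ij},\qquad (\Delta^{d,h}u)(x_i)=\frac{2(m+2)}{h^2}\sum_j\frac{w_{ij}}{m_i}\bigl(u(x_i)-u(x_j)\bigr),$$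 and let $\lambda_k(\Delta^{d,h})$, $1\le k\le n$, be the $k$-th smallest eigenvalue of the random-walk Laplacian $\Delta^{d,h}$, counted with multiplicity. **Theorem.** There are absolute constants $C,c>0$, constants $C_1,C_2>0$ depending only on $m,\beta,L_1$, and $h_0>0$ depending only on $(\mathcal M,g),\beta,L_1$ such that the following holds for all $n$, all $0<h\le h_0$ and all $\delta\ge0$ with $m\delta\le c$. Let $d_0$ be a (random) distance function on the sample such that, with probability at least $1-\varepsilon_n$, $$\eta\!\left(\frac{d_g(x_i,x_j)}{h(1-\delta)}\right)\le\eta\!\left(\frac{d_0(x_i,x_j)}{h}\right)\le\eta\!\left(\frac{d_g(x_i,x_j)}{h(1+\delta)}\right)\qquad\text{for all } i,j.$$ Then, with probability at least $1-\varepsilon_n$, for every transport map $T$ from $\nu$ to $\nu_n$ with $m\,d_\infty\le c\,h$ and every $1\le k\le n$, $$(1-E)\,\lambda_k\bigl(\Delta^{d_g,h(1-\delta)}\bigr)\;\le\;\lambda_k\bigl(\Delta^{d_0,h}\bigr)\;\le\;(1+E)\,\lambda_k\bigl(\Delta^{d_g,h(1+\delta)}\bigr),$$ where $$E=C\,m\,\delta+C\,\beta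 L_1h+C\,m\,\beta^2\,\frac{d_\infty}{h}+C_1h^2+C_2\,\delta h .$$ (An event $A$ has probability at least $1-\varepsilon$ in the sense that its complement has outer measure at most $\varepsilon$.) -/

import Mathlib

open MeasureTheory ProbabilityTheory Set Bundle Manifold
open scoped ENNReal NNReal ContDiff

noncomputable section

/-! ### Riemannian volume and distributions with a density -/

section Volume

variable (m : ℕ) {M : Type*} [TopologicalSpace M] [ChartedSpace (EuclideanSpace ℝ (Fin m)) M]
  [RiemannianBundle (fun x : M => TangentSpace (𝓡 m) x)]

/-- The `i`-th coordinate vector field `∂ᵢ` of the chart `φ` around `x₀`, at the point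
`φ⁻¹(z)`: the image of the standard basis vector `eᵢ` under the differential of `φ⁻¹` at `z`. -/
def coordVector (x₀ : M) (z : EuclideanSpace ℝ (Fin m)) (i : Fin m) :
    TangentSpace (𝓡 m) ((extChartAt (𝓡 m) x₀).symm z) :=
  mfderiv 𝓘(ℝ, EuclideanSpace ℝ (Fin m)) (𝓡 m) (extChartAt (𝓡 m) x₀).symm z
    (EuclideanSpace.single i (1 : ℝ))

/-- The matrix `gᵢⱼ = g(∂ᵢ, ∂ⱼ)` of the Riemannian metric in the chart around `x₀`. -/
def gramMatrix (x₀ : M) (z : EuclideanSpace ℝ (Fin m)) : Matrix (Fin m) (Fin m) ℝ :=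
  Matrix.of fun i j => inner ℝ (coordVector m x₀ z i) (coordVector m x₀ z j)

/-- The measure `√det(gᵢⱼ) dx¹⋯dxᵐ` of the chart around `x₀`, as a measure on `M` that is
concentrated on the domain of this chart. -/
def chartVolume [MeasurableSpace M] (x₀ : M) : Measure M :=
  ((volume.restrict (extChartAt (𝓡 m) x₀).target).withDensity
    fun z => ENNReal.ofReal (√(gramMatrix m x₀ z).det)).map (extChartAt (𝓡 m) x₀).symm

variable (M) in
/-- The Riemannian volume measure `dVol`. By the change of variables formula the measures
`√det(gᵢⱼ) dx¹⋯dxᵐ` of two charts agree on the overlap of the two chart domains; their supremum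
is the measure on `M` that restricts to `√det(gᵢⱼ) dx¹⋯dxᵐ` on each chart domain. -/
def riemannianVolume [MeasurableSpace M] : Measure M :=
  ⨆ x₀ : M, chartVolume m x₀

/-- The measure `ν = ρ dVol`. -/
def densityMeasure [MeasurableSpace M] (ρ : M → ℝ) : Measure M :=
  (riemannianVolume m M).withDensity fun x => ENNReal.ofReal (ρ x)

end Volume

/-! ### Empirical measure and transport maps -/

section Transport

variable {M : Type*} [MeasurableSpace M]

/-- The empirical measure `νₙ = (1/n) ∑ᵢ δ_{xᵢ}`. -/
def empiricalMeasure {n : ℕ} (x : Fin n → M) : Measure M :=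
  (n : ℝ≥0∞)⁻¹ • ∑ i, Measure.dirac (x i)

/-- `T` is a transport map from `ν` to `ν'`, that is, `T_# ν = ν'`. -/
def IsTransportMap (ν ν' : Measure M) (T : M → M) : Prop :=
  Measurable T ∧ ν.map T = ν'

/-- `ess sup_x d(x, T x)`, the essential supremum being taken with respect to `ν`. -/
def transportDist [PseudoMetricSpace M] (ν : Measure M) (T : M → M) : ℝ :=
  (essSup (fun x => edist x (T x)) ν).toReal

end Transport

/-! ### Proximity graphs and their random-walk Laplacians

A distance function on the point cloud `x₁, …, xₙ` is given by the numbers `d i j = d(xᵢ, xⱼ)`,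
and a function on the point cloud by the numbers `u i = u(xᵢ)`. -/

section Graph

/-- The volume `ω_m` of the unit ball of `ℝᵐ`. -/
def unitBallVolume (m : ℕ) : ℝ :=
  (volume (Metric.ball (0 : EuclideanSpace ℝ (Fin m)) 1)).toReal

/-- The kernel `η = ω_m⁻¹ 𝟙_[0,1]`. -/
def kernelEta (m : ℕ) (t : ℝ) : ℝ :=
  (Icc (0 : ℝ) 1).indicator (fun _ => 1 / unitBallVolume m) t

variable {n : ℕ}

/-- A (discrete) distance function on an `n`-point cloud. The triangle inequality is not
required. -/
structure IsDistanceFunction (d : Fin n → Fin n → ℝ) : Prop where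
  nonneg : ∀ i j, 0 ≤ d i j
  self_eq_zero : ∀ i, d i i = 0
  symm : ∀ i j, d i j = d j i

/-- The weights `wᵢⱼ = η(d(xᵢ, xⱼ)/h) / (n hᵐ)`. -/
def graphWeight (m : ℕ) (d : Fin n → Fin n → ℝ) (h : ℝ) (i j : Fin n) : ℝ :=
  1 / (n * h ^ m) * kernelEta m (d i j / h)

/-- The degree `mᵢ = ∑ⱼ wᵢⱼ`. -/
def graphDegree (m : ℕ) (d : Fin n → Fin n → ℝ) (h : ℝ) (i : Fin n) : ℝ :=
  ∑ j, graphWeight m d h i j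

/-- The random-walk Laplacian
`(Δu)(xᵢ) = (2(m+2)/h²) ∑ⱼ (wᵢⱼ/mᵢ) (u(xᵢ) - u(xⱼ))`. -/
def rwLaplacian (m : ℕ) (d : Fin n → Fin n → ℝ) (h : ℝ) :
    (Fin n → ℝ) →ₗ[ℝ] (Fin n → ℝ) where
  toFun u i := 2 * (m + 2) / h ^ 2 *
    ∑ j, graphWeight m d h i j / graphDegree m d h i * (u i - u j)
  map_add' u v := by
    ext i
    simp only [Pi.add_apply, ← mul_add, ← Finset.sum_add_distrib]
    congr 1
    exact Finset.sum_congr rfl fun j _ => by ring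
  map_smul' a u := by
    ext i
    simp only [Pi.smul_apply, smul_eq_mul, RingHom.id_apply, Finset.mul_sum]
    exact Finset.sum_congr rfl fun j _ => by ring

/-- The `k`-th smallest eigenvalue of `A`, for `k = 1, 2, …`, eigenvalues being counted with
multiplicity: the `k`-th entry of the increasingly ordered list of real roots of the
characteristic polynomial. It is meaningful for `1 ≤ k ≤ n` and for operators all of whose
eigenvalues are real, such as the random-walk Laplacian of a weighted graph. -/
def kthEigenvalue (A : (Fin n → ℝ) →ₗ[ℝ] (Fin n → ℝ)) (k : ℕ) : ℝ :=
  (A.charpoly.roots.sort (· ≤ ·)).getD (k - 1) 0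

/-- The kernel sandwich
`η(d_g(xᵢ,xⱼ)/(h(1-δ))) ≤ η(d₀(xᵢ,xⱼ)/h) ≤ η(d_g(xᵢ,xⱼ)/(h(1+δ)))` for all `i, j`. -/
def KernelSandwich (m : ℕ) (dg d0 : Fin n → Fin n → ℝ) (h δ : ℝ) : Prop :=
  ∀ i j, kernelEta m (dg i j / (h * (1 - δ))) ≤ kernelEta m (d0 i j / h) ∧
    kernelEta m (d0 i j / h) ≤ kernelEta m (dg i j / (h * (1 + δ)))

/-- The geodesic distances `d_g(xᵢ, xⱼ)` between the points of a point cloud. -/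
def cloudDist {M : Type*} [PseudoMetricSpace M] (x : Fin n → M) (i j : Fin n) : ℝ :=
  dist (x i) (x j)

end Graph

end

/-! The eigenvalues of a random-walk Laplacian are min-max values of the quotient of the Dirichlet
form `∑ W i j (u i - u j)²` by the degree-weighted norm `∑ D i (u i)²`, up to the factor `κ / 2`.
The kernel sandwich says that the weights of the graph of `d0` lie between those of the geodesic
graphs of radii `h (1 - δ)` and `h (1 + δ)`. Dirichlet forms increase with the weights, so only the
norms remain to be compared: if the outer degrees are at most `K` times the inner ones, neighbouring
graphs have eigenvalues comparable up to `K` and the ratio of the squared bandwidths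
(`kthEigenvalue_le`, `kthEigenvalue_rwLaplacian_le`).

A geodesic degree is, up to a constant factor, the empirical mass of a ball. The transport map
replaces it by the `ν`-mass of a ball whose radius is changed by `d_∞`. It remains to compare the
masses of concentric balls of radii `h (1 + δ) + d_∞` and `h (1 - δ) - d_∞`
(`sum_kernelEta_le_mul`). The Lipschitz density costs a relative error of order `β L₁ h`. For the
volume, the larger ball is contracted linearly in a chart towards its centre with ratio `1 - s`. In
a small enough chart ball the metric varies so little that distances to the centre shrink at least
by `1 - s / 2`, while volume shrinks at most by about `(1 - s) ^ m` (`dist_chartContraction_le`,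
`exists_forall_mul_volume_closedBall_le`). With `s` of order `δ + d_∞ / h` this gives `K = 1 + O(m δ
+ m d_∞ / h + β L₁ h)`. No curvature enters; the geometry of `M` only limits the size of `h`.

Everything after the kernel sandwich is deterministic, so the probability of failure is not
increased. -/

/-! ### Eigenvalues of random-walk Laplacians -/

section Eigenvalues

variable {n : ℕ}

/-- The random-walk Laplacian `κ (1 - D⁻¹ W)` of a weight matrix `W` with row sums `D`. -/
noncomputable def weightLaplacian (κ : ℝ) (W : Matrix (Fin n) (Fin n) ℝ) :
    Matrix (Fin n) (Fin n) ℝ :=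
  Matrix.of fun i j => κ * ((1 : Matrix (Fin n) (Fin n) ℝ) i j - W i j / ∑ l, W i l)

/-- The symmetric matrix `κ (1 - D^{-1/2} W D^{-1/2})`. -/
noncomputable def symmLaplacian (κ : ℝ) (W : Matrix (Fin n) (Fin n) ℝ) :
    Matrix (Fin n) (Fin n) ℝ :=
  Matrix.of fun i j =>
    κ * ((1 : Matrix (Fin n) (Fin n) ℝ) i j - W i j / (√(∑ l, W i l) * √(∑ l, W j l)))

lemma symmLaplacian_isHermitian (κ : ℝ) {W : Matrix (Fin n) (Fin n) ℝ}
    (hW : ∀ i j, W i j = W j i) : (symmLaplacian κ W).IsHermitian := by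
  ext i j
  simp only [symmLaplacian, Matrix.conjTranspose_apply, Matrix.of_apply, star_trivial]
  rw [hW j i, mul_comm (√(∑ l, W j l)), ← Matrix.transpose_apply (1 : Matrix (Fin n) (Fin n) ℝ),
    Matrix.transpose_one]

/-- Conjugation by `D^{1/2}` turns one matrix into the other; the spectral theorem then applies to a
Laplacian that is not itself symmetric. -/
lemma charpoly_weightLaplacian (κ : ℝ) {W : Matrix (Fin n) (Fin n) ℝ}
    (hD : ∀ i, 0 < ∑ l, W i l) :
    (weightLaplacian κ W).charpoly = (symmLaplacian κ W).charpoly := by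
  set s : Fin n → ℝ := fun i => √(∑ l, W i l) with hs
  have hs0 : ∀ i, s i ≠ 0 := fun i => (Real.sqrt_pos.2 (hD i)).ne'
  have hss : ∀ i, s i * s i = ∑ l, W i l := fun i => Real.mul_self_sqrt (hD i).le
  suffices hS : symmLaplacian κ W =
      Matrix.diagonal s * (weightLaplacian κ W * Matrix.diagonal fun i => (s i)⁻¹) by
    rw [hS, Matrix.charpoly_mul_comm, Matrix.mul_assoc, Matrix.diagonal_mul_diagonal]
    simp [hs0]
  ext i j
  rw [Matrix.diagonal_mul, Matrix.mul_diagonal]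
  simp only [weightLaplacian, symmLaplacian, Matrix.of_apply]
  have hi := hs0 i
  have hj := hs0 j
  change κ * (_ - W i j / (s i * s j)) = _
  rw [← hss i]
  rcases eq_or_ne i j with rfl | hij
  · rw [Matrix.one_apply_eq]; field_simp
  · rw [Matrix.one_apply_ne hij]; field_simp; ring

lemma sort_charpoly_roots {S : Matrix (Fin n) (Fin n) ℝ} (hS : S.IsHermitian) :
    S.charpoly.roots.sort (· ≤ ·) =
      List.ofFn (hS.eigenvalues ∘ Tuple.sort hS.eigenvalues) := by
  have h : S.charpoly.roots = (List.ofFn (hS.eigenvalues ∘ Tuple.sort hS.eigenvalues) :) := by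
    rw [hS.roots_charpoly_eq_eigenvalues, ← List.map_ofFn, ← Multiset.map_coe]
    change Multiset.map hS.eigenvalues _ = _
    have h1 : (List.ofFn (Tuple.sort hS.eigenvalues) : Multiset (Fin n)) = Finset.univ.val := by
      have := Fin.univ_val_map (Tuple.sort hS.eigenvalues)
      rw [← this]
      exact congrArg Finset.val (Finset.map_univ_equiv (Tuple.sort hS.eigenvalues))
    rw [h1]
  rw [h, Multiset.coe_sort]
  exact List.mergeSort_of_pairwise (by
    simpa using (Tuple.monotone_sort hS.eigenvalues).sortedLE_ofFn.pairwise)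

/-- Simultaneous diagonalization of the Dirichlet form and of the weighted norm of a weighted
graph by the eigenvalues of its random-walk Laplacian. -/
lemma exists_diagonalization (κ : ℝ) {W : Matrix (Fin n) (Fin n) ℝ}
    (hW : ∀ i j, W i j = W j i) (hD : ∀ i, 0 < ∑ l, W i l)
    {A : (Fin n → ℝ) →ₗ[ℝ] (Fin n → ℝ)} (hA : LinearMap.toMatrix' A = weightLaplacian κ W) :
    ∃ (μ : Fin n → ℝ) (Φ : (Fin n → ℝ) →ₗ[ℝ] (Fin n → ℝ)), Monotone μ ∧
      (∀ k : Fin n, kthEigenvalue A (k + 1) = μ k) ∧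
      (∀ u, ∑ i, (Φ u i) ^ 2 = ∑ i, (∑ l, W i l) * u i ^ 2) ∧
      ∀ u, ∑ i, μ i * (Φ u i) ^ 2 = κ / 2 * ∑ i, ∑ j, W i j * (u i - u j) ^ 2 := by
  set s : Fin n → ℝ := fun i => √(∑ l, W i l) with hs
  have hs0 : ∀ i, s i ≠ 0 := fun i => (Real.sqrt_pos.2 (hD i)).ne'
  have hss : ∀ i, s i * s i = ∑ l, W i l := fun i => Real.mul_self_sqrt (hD i).le
  have hS := symmLaplacian_isHermitian κ hW
  set S := symmLaplacian κ W with hSdef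
  set σ := Tuple.sort hS.eigenvalues
  let b := hS.eigenvectorBasis
  -- `toE u = D^{1/2} u`, and `Φ u` lists its coordinates in the eigenbasis of `S`, reordered by
  -- increasing eigenvalue. Parseval gives the weighted norm.
  let toE : (Fin n → ℝ) →ₗ[ℝ] EuclideanSpace ℝ (Fin n) :=
    (WithLp.linearEquiv 2 ℝ (Fin n → ℝ)).symm.toLinearMap ∘ₗ
      (Matrix.toLin' (Matrix.diagonal s))
  have htoE : ∀ u i, toE u i = s i * u i := by
    intro u i
    simp [toE, Matrix.mulVec_diagonal]
  let Φ : (Fin n → ℝ) →ₗ[ℝ] (Fin n → ℝ) :=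
    { toFun := fun u i => inner ℝ (b (σ i)) (toE u)
      map_add' := fun u v => by ext i; simp [inner_add_right]
      map_smul' := fun a u => by ext i; simp [inner_smul_right] }
  have hbS : ∀ i, S.mulVec (b i) = hS.eigenvalues i • (b i : Fin n → ℝ) := by
    intro i; exact hS.mulVec_eigenvectorBasis i
  refine ⟨hS.eigenvalues ∘ σ, Φ, Tuple.monotone_sort _, ?_, ?_, ?_⟩
  · intro k
    rw [kthEigenvalue, ← LinearMap.charpoly_toMatrix A (Pi.basisFun ℝ (Fin n)),
      LinearMap.toMatrix_eq_toMatrix', hA, charpoly_weightLaplacian κ hD, sort_charpoly_roots hS]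
    simp [σ]
  · intro u
    have h1 := b.sum_sq_norm_inner_right (toE u)
    rw [EuclideanSpace.norm_sq_eq, ← Equiv.sum_comp σ] at h1
    simp only [htoE, Real.norm_eq_abs, sq_abs] at h1
    change ∑ i, (inner ℝ (b (σ i)) (toE u)) ^ 2 = _
    rw [h1]
    exact Finset.sum_congr rfl fun i _ => by rw [← hss]; ring
  · intro u
    change ∑ i, hS.eigenvalues (σ i) * (inner ℝ (b (σ i)) (toE u)) ^ 2 = _
    rw [Equiv.sum_comp σ fun i => hS.eigenvalues i * (inner ℝ (b i) (toE u)) ^ 2]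
    have h2 : ∀ i, hS.eigenvalues i * inner ℝ (b i) (toE u) =
        inner ℝ (b i) (WithLp.toLp 2 (S.mulVec (toE u))) := by
      intro i
      rw [EuclideanSpace.inner_eq_star_dotProduct, EuclideanSpace.inner_eq_star_dotProduct]
      simp only [star_trivial]
      have hT : S.transpose = S := by simpa using hS.eq
      rw [dotProduct_comm, ← smul_eq_mul, ← smul_dotProduct, ← hbS i,
        dotProduct_comm (S.mulVec _), Matrix.dotProduct_mulVec, ← Matrix.mulVec_transpose, hT,
        dotProduct_comm]
    have h3 : ∑ i, hS.eigenvalues i * (inner ℝ (b i) (toE u)) ^ 2 =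
        inner ℝ (toE u) (WithLp.toLp 2 (S.mulVec (toE u))) := by
      rw [← b.sum_inner_mul_inner]
      refine Finset.sum_congr rfl fun i _ => ?_
      rw [← h2, real_inner_comm (b i)]; ring
    rw [h3, EuclideanSpace.inner_eq_star_dotProduct]
    simp only [star_trivial, dotProduct, Matrix.mulVec]
    simp only [htoE, hSdef, symmLaplacian, Matrix.of_apply]
    have h4 : ∀ i j, κ * ((1 : Matrix (Fin n) (Fin n) ℝ) i j - W i j / (s i * s j)) * (s j * u j)
        * (s i * u i) = κ * ((1 : Matrix (Fin n) (Fin n) ℝ) i j * (s i * u i) * (s j * u j)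
          - W i j * u i * u j) := by
      intro i j
      have hi := hs0 i
      have hj := hs0 j
      field_simp
    simp only [Finset.sum_mul]
    rw [Finset.sum_congr rfl fun i _ => Finset.sum_congr rfl fun j _ => h4 i j]
    simp only [← Finset.mul_sum, Finset.sum_sub_distrib]
    have h5 : ∀ i, ∑ j, (1 : Matrix (Fin n) (Fin n) ℝ) i j * (s i * u i) * (s j * u j)
        = ∑ j, W i j * u i ^ 2 := by
      intro i
      rw [Finset.sum_eq_single i (fun j _ hj => by rw [Matrix.one_apply_ne hj.symm]; ring)
        (by simp), Matrix.one_apply_eq, ← Finset.sum_mul, ← hss]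
      ring
    -- Symmetry of `W` lets half of each diagonal sum complete the square.
    have h6 : ∑ i, ∑ j, W i j * u j ^ 2 = ∑ i, ∑ j, W i j * u i ^ 2 := by
      rw [Finset.sum_comm]
      exact Finset.sum_congr rfl fun i _ => Finset.sum_congr rfl fun j _ => by rw [hW]
    have h7 : ∑ i, ∑ j, W i j * (u i - u j) ^ 2 = ∑ i, ∑ j, W i j * u i ^ 2 +
        ∑ i, ∑ j, W i j * u j ^ 2 - 2 * ∑ i, ∑ j, W i j * u i * u j := by
      simp only [Finset.mul_sum, ← Finset.sum_add_distrib, ← Finset.sum_sub_distrib]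
      exact Finset.sum_congr rfl fun i _ => Finset.sum_congr rfl fun j _ => by ring
    rw [h7, h6, Finset.sum_congr rfl fun i _ => h5 i]
    ring

/-- A dimension count in the style of Courant and Fischer for two pairs of simultaneously
diagonalized quadratic forms. -/
lemma exists_coeff_mul_le {μ ν : Fin n → ℝ} (hμ : Monotone μ) (hν : Monotone ν)
    (Φ Ψ : (Fin n → ℝ) →ₗ[ℝ] (Fin n → ℝ))
    (hE : ∀ u, ∑ i, μ i * (Φ u i) ^ 2 ≤ ∑ i, ν i * (Ψ u i) ^ 2) (k : Fin n) :
    ∃ u ≠ 0, μ k * ∑ i, (Φ u i) ^ 2 ≤ ν k * ∑ i, (Ψ u i) ^ 2 := by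
  -- These are `n - 1` linear conditions on `n` unknowns: the `Φ`-coordinates below `k` and the
  -- `Ψ`-coordinates above `k` vanish. On a nonzero solution the first form is at least `μ k` times
  -- its norm, the second at most `ν k` times its norm.
  let F : (Fin n → ℝ) →ₗ[ℝ] ({i : Fin n // i ≠ k} → ℝ) :=
    LinearMap.pi fun i => if i.1 < k then (LinearMap.proj i.1) ∘ₗ Φ else (LinearMap.proj i.1) ∘ₗ Ψ
  have hF : LinearMap.ker F ≠ ⊥ := by
    apply LinearMap.ker_ne_bot_of_finrank_lt
    have := k.pos
    simp
    omega
  obtain ⟨u, hu, hu0⟩ := Submodule.exists_mem_ne_zero_of_ne_bot hF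
  have hu' : ∀ i (hi : i ≠ k), F u ⟨i, hi⟩ = 0 := fun i hi => by
    rw [LinearMap.mem_ker.1 hu]; rfl
  have h1 : ∀ i < k, Φ u i = 0 := fun i hi => by
    have := hu' i hi.ne
    simpa [F, hi] using this
  have h2 : ∀ i, k < i → Ψ u i = 0 := fun i hi => by
    have := hu' i hi.ne'
    simpa [F, hi.not_gt] using this
  refine ⟨u, hu0, ?_⟩
  calc μ k * ∑ i, (Φ u i) ^ 2 ≤ ∑ i, μ i * (Φ u i) ^ 2 := by
        rw [Finset.mul_sum]
        refine Finset.sum_le_sum fun i _ => ?_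
        rcases lt_or_ge i k with hi | hi
        · simp [h1 i hi]
        · exact mul_le_mul_of_nonneg_right (hμ hi) (sq_nonneg _)
    _ ≤ ∑ i, ν i * (Ψ u i) ^ 2 := hE u
    _ ≤ ν k * ∑ i, (Ψ u i) ^ 2 := by
        rw [Finset.mul_sum]
        refine Finset.sum_le_sum fun i _ => ?_
        rcases lt_or_ge k i with hi | hi
        · simp [h2 i hi]
        · exact mul_le_mul_of_nonneg_right (hν hi) (sq_nonneg _)

/-- Monotonicity of the eigenvalues of random-walk Laplacians: `λₖ(A) ≤ t λₖ(B)` if the Dirichlet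
form of `A` is at most that of `B` and the degrees of `B` are at most `t` times those of `A`. -/
lemma kthEigenvalue_le {κ₁ κ₂ : ℝ} (hκ₁ : 0 ≤ κ₁) (hκ₂ : 0 < κ₂)
    {V W : Matrix (Fin n) (Fin n) ℝ}
    (hV : ∀ i j, V i j = V j i) (hW : ∀ i j, W i j = W j i)
    (hDV : ∀ i, 0 < ∑ l, V i l) (hDW : ∀ i, 0 < ∑ l, W i l)
    {A B : (Fin n → ℝ) →ₗ[ℝ] (Fin n → ℝ)} (hA : LinearMap.toMatrix' A = weightLaplacian κ₁ V)
    (hB : LinearMap.toMatrix' B = weightLaplacian κ₂ W)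
    (hV0 : ∀ i j, 0 ≤ W i j) (hVW : ∀ i j, V i j ≤ W i j) {t : ℝ}
    (hD : ∀ i, ∑ l, W i l ≤ t * ∑ l, V i l) {k : ℕ} (hk : 1 ≤ k) (hkn : k ≤ n) :
    0 ≤ kthEigenvalue B k ∧ kthEigenvalue A k ≤ t * (κ₁ / κ₂) * kthEigenvalue B k := by
  obtain ⟨μ, Φ, hμ, hμA, hΦ, hEA⟩ := exists_diagonalization κ₁ hV hDV hA
  obtain ⟨ν, Ψ, hν, hνB, hΨ, hEB⟩ := exists_diagonalization κ₂ hW hDW hB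
  have hpos : ∀ {D : Fin n → ℝ}, (∀ i, 0 < D i) → ∀ u : Fin n → ℝ, u ≠ 0 →
      0 < ∑ i, D i * u i ^ 2 := by
    intro D hD u hu
    obtain ⟨i, hi⟩ := Function.ne_iff.1 hu
    exact Finset.sum_pos' (fun j _ => mul_nonneg (hD j).le (sq_nonneg _))
      ⟨i, Finset.mem_univ i, mul_pos (hD i) (by have : u i ≠ 0 := hi; positivity)⟩
  -- Eigenvalues are numbered from `1`, indices in `Fin n` from `0`.
  obtain ⟨k, rfl⟩ : ∃ j : Fin n, k = j + 1 := ⟨⟨k - 1, by omega⟩, by simp; omega⟩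
  rw [hμA, hνB]
  have hν0 : 0 ≤ ν k := by
    -- Comparison with the zero form yields nonnegativity.
    obtain ⟨u, hu, h⟩ := exists_coeff_mul_le (μ := 0) monotone_const hν Ψ Ψ (fun u => by
      rw [hEB]
      simp only [Pi.zero_apply, zero_mul, Finset.sum_const_zero]
      exact mul_nonneg (by positivity) (Finset.sum_nonneg fun i _ => Finset.sum_nonneg fun j _ =>
        mul_nonneg (hV0 i j) (sq_nonneg _))) k
    have h1 := hpos hDW u hu
    rw [← hΨ] at h1
    simp only [Pi.zero_apply, zero_mul] at h
    exact nonneg_of_mul_nonneg_left h h1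
  refine ⟨hν0, ?_⟩
  set r := κ₁ / κ₂ with hr
  have hr0 : 0 ≤ r := by positivity
  obtain ⟨u, hu, h⟩ := exists_coeff_mul_le hμ (ν := fun i => r * ν i)
    (fun i j hij => mul_le_mul_of_nonneg_left (hν hij) hr0) Φ Ψ (fun u => by
      simp only [mul_assoc]
      rw [hEA, ← Finset.mul_sum, hEB, ← mul_assoc,
        show r * (κ₂ / 2) = κ₁ / 2 by rw [hr]; field_simp]
      exact mul_le_mul_of_nonneg_left (Finset.sum_le_sum fun i _ => Finset.sum_le_sum fun j _ =>
        mul_le_mul_of_nonneg_right (hVW i j) (sq_nonneg _)) (by positivity)) k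
  have h1 := hpos hDV u hu
  rw [← hΦ] at h1
  have h2 : ∑ i, (Ψ u i) ^ 2 ≤ t * ∑ i, (Φ u i) ^ 2 := by
    rw [hΨ, hΦ, Finset.mul_sum]
    refine Finset.sum_le_sum fun i _ => ?_
    rw [← mul_assoc]
    exact mul_le_mul_of_nonneg_right (hD i) (sq_nonneg _)
  refine le_of_mul_le_mul_right (h.trans ?_) h1
  calc r * ν k * ∑ i, (Ψ u i) ^ 2 ≤ r * ν k * (t * ∑ i, (Φ u i) ^ 2) :=
        mul_le_mul_of_nonneg_left h2 (mul_nonneg hr0 hν0)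
    _ = _ := by ring

/-- The matrix of the random-walk Laplacian of a proximity graph. The weights are taken without
the factor `1 / (n hᵐ)`, which cancels. -/
lemma toMatrix_rwLaplacian (m : ℕ) (d : Fin n → Fin n → ℝ) {h : ℝ} (hh : 0 < h)
    (hD : ∀ i, 0 < ∑ l, kernelEta m (d i l / h)) :
    LinearMap.toMatrix' (rwLaplacian m d h) =
      weightLaplacian (2 * (m + 2) / h ^ 2) (Matrix.of fun i j => kernelEta m (d i j / h)) := by
  ext i j
  have hn : (0 : ℝ) < n := by exact_mod_cast i.pos
  have hw : ∀ l, graphWeight m d h i l / graphDegree m d h i =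
      kernelEta m (d i l / h) / ∑ l, kernelEta m (d i l / h) := by
    intro l
    simp only [graphDegree, graphWeight, ← Finset.mul_sum]
    rw [mul_div_mul_left _ _ (by positivity)]
  rw [LinearMap.toMatrix'_apply]
  simp only [rwLaplacian, LinearMap.coe_mk, AddHom.coe_mk, weightLaplacian, Matrix.of_apply, hw]
  congr 1
  simp only [mul_sub, Finset.sum_sub_distrib, ← Finset.sum_mul]
  rw [← Finset.sum_div, div_self (hD i).ne', one_mul, Matrix.one_apply]
  simp [Pi.single_apply]

end Eigenvalues

/-! ### Variation of the metric in a small chart ball -/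

section ChartMetric

variable {m : ℕ} {M : Type*} [TopologicalSpace M] [ChartedSpace (EuclideanSpace ℝ (Fin m)) M]

/-- The Riemannian metric at `y`, on vectors of the model space. -/
noncomputable def metricForm [RiemannianBundle (fun x : M => TangentSpace (𝓡 m) x)] (y : M)
    (v w : EuclideanSpace ℝ (Fin m)) : ℝ :=
  inner ℝ (show TangentSpace (𝓡 m) y from v) (show TangentSpace (𝓡 m) y from w)

/-- The differential of the inverse of the chart around `x₀`. -/
noncomputable def chartSymmDeriv (x₀ : M) (z : EuclideanSpace ℝ (Fin m)) :
    EuclideanSpace ℝ (Fin m) →L[ℝ] EuclideanSpace ℝ (Fin m) :=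
  mfderiv 𝓘(ℝ, EuclideanSpace ℝ (Fin m)) (𝓡 m) (extChartAt (𝓡 m) x₀).symm z

variable [RiemannianBundle (fun x : M => TangentSpace (𝓡 m) x)]

lemma gramMatrix_apply (x₀ : M) (z : EuclideanSpace ℝ (Fin m)) (i j : Fin m) :
    gramMatrix m x₀ z i j = metricForm ((extChartAt (𝓡 m) x₀).symm z)
      (chartSymmDeriv x₀ z (EuclideanSpace.single i 1))
      (chartSymmDeriv x₀ z (EuclideanSpace.single j 1)) := rfl

lemma metricForm_add_left (y : M) (u v w : EuclideanSpace ℝ (Fin m)) :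
    metricForm y (u + v) w = metricForm y u w + metricForm y v w :=
  inner_add_left (𝕜 := ℝ) (E := TangentSpace (𝓡 m) y) u v w

lemma metricForm_smul_left (y : M) (a : ℝ) (v w : EuclideanSpace ℝ (Fin m)) :
    metricForm y (a • v) w = a * metricForm y v w :=
  real_inner_smul_left (F := TangentSpace (𝓡 m) y) v w a

lemma metricForm_comm (y : M) (v w : EuclideanSpace ℝ (Fin m)) :
    metricForm y v w = metricForm y w v :=
  real_inner_comm (F := TangentSpace (𝓡 m) y) w v

lemma metricForm_self (y : M) (v : EuclideanSpace ℝ (Fin m)) :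
    metricForm y v v = ‖(show TangentSpace (𝓡 m) y from v)‖ ^ 2 :=
  real_inner_self_eq_norm_sq (F := TangentSpace (𝓡 m) y) v

variable [IsManifold (𝓡 m) ∞ M]
  [IsContMDiffRiemannianBundle (𝓡 m) ∞ (EuclideanSpace ℝ (Fin m))
        (fun x : M => TangentSpace (𝓡 m) x)]

/-- The coordinate fields are the tangent map of the inverse chart applied to constant fields. Class
`C¹` suffices, since only local Lipschitz bounds are extracted. -/
lemma contDiffOn_gramMatrix (x₀ : M) (i j : Fin m) :
    ContDiffOn ℝ 1 (fun z => gramMatrix m x₀ z i j) (extChartAt (𝓡 m) x₀).target := by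
  have hT : IsOpen (extChartAt (𝓡 m) x₀).target := isOpen_extChartAt_target x₀
  have key : ∀ i, ContMDiffOn 𝓘(ℝ, EuclideanSpace ℝ (Fin m)) ((𝓡 m).tangent) 1
      (fun z => (⟨(extChartAt (𝓡 m) x₀).symm z, coordVector m x₀ z i⟩ : TangentBundle (𝓡 m) M))
      (extChartAt (𝓡 m) x₀).target := by
    intro i
    have h1 := (contMDiffOn_extChartAt_symm (I := 𝓡 m) (n := ∞)
      x₀).contMDiffOn_tangentMapWithin (m := 1) (by norm_cast) hT.uniqueMDiffOn
    have h2 : ContMDiffOn 𝓘(ℝ, EuclideanSpace ℝ (Fin m)) 𝓘(ℝ, EuclideanSpace ℝ (Fin m)).tangent 1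
        (fun z => (⟨z, EuclideanSpace.single i (1 : ℝ)⟩ :
          TangentBundle 𝓘(ℝ, EuclideanSpace ℝ (Fin m)) (EuclideanSpace ℝ (Fin m))))
        (extChartAt (𝓡 m) x₀).target := by
      exact contMDiffOn_vectorSpace_iff_contDiffOn.2 contDiffOn_const
    refine (h1.comp h2 fun z hz => hz).congr fun z hz => ?_
    simp only [Function.comp_apply, tangentMapWithin]
    rw [mfderivWithin_of_isOpen hT hz]
    rfl
  have : IsContMDiffRiemannianBundle (𝓡 m) 1 (EuclideanSpace ℝ (Fin m))
      (fun x : M => TangentSpace (𝓡 m) x) :=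
    IsContMDiffRiemannianBundle.of_le (n := ∞) (by norm_cast)
  have h2 := (key i).inner_bundle (key j)
  exact contMDiffOn_iff_contDiffOn.1 h2

omit [IsContMDiffRiemannianBundle (𝓡 m) ∞ (EuclideanSpace ℝ (Fin m))
        (fun x : M => TangentSpace (𝓡 m) x)]
  [RiemannianBundle (fun x : M => TangentSpace (𝓡 m) x)] in
lemma chartSymmDeriv_comp_mfderiv (x₀ : M) {y : M} (hy : y ∈ (extChartAt (𝓡 m) x₀).source)
    (w : EuclideanSpace ℝ (Fin m)) :
    chartSymmDeriv x₀ (extChartAt (𝓡 m) x₀ y)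
      ((mfderiv (𝓡 m) 𝓘(ℝ, EuclideanSpace ℝ (Fin m)) (extChartAt (𝓡 m) x₀) y :
        EuclideanSpace ℝ (Fin m) →L[ℝ] EuclideanSpace ℝ (Fin m)) w) = w := by
  have h := mfderivWithin_extChartAt_symm_comp_mfderiv_extChartAt' (I := 𝓡 m) hy
  have h2 := congrArg (fun L : EuclideanSpace ℝ (Fin m) →L[ℝ] EuclideanSpace ℝ (Fin m) => L w) h
  simp only [ModelWithCorners.range_eq_univ, mfderivWithin_univ] at h2
  exact h2

omit [IsContMDiffRiemannianBundle (𝓡 m) ∞ (EuclideanSpace ℝ (Fin m))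
        (fun x : M => TangentSpace (𝓡 m) x)]
  [RiemannianBundle (fun x : M => TangentSpace (𝓡 m) x)] in
lemma mfderiv_comp_chartSymmDeriv (x₀ : M) {y : M} (hy : y ∈ (extChartAt (𝓡 m) x₀).source)
    (v : EuclideanSpace ℝ (Fin m)) :
    (mfderiv (𝓡 m) 𝓘(ℝ, EuclideanSpace ℝ (Fin m)) (extChartAt (𝓡 m) x₀) y :
        EuclideanSpace ℝ (Fin m) →L[ℝ] EuclideanSpace ℝ (Fin m))
      (chartSymmDeriv x₀ (extChartAt (𝓡 m) x₀ y) v) = v := by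
  have h := mfderiv_extChartAt_comp_mfderivWithin_extChartAt_symm' (I := 𝓡 m) hy
  have h2 := congrArg (fun L : EuclideanSpace ℝ (Fin m) →L[ℝ] EuclideanSpace ℝ (Fin m) => L v) h
  simp only [ModelWithCorners.range_eq_univ, mfderivWithin_univ] at h2
  exact h2

/-- The differential of the chart is the trivialization of the tangent bundle at `x₀`, whose
operator norm is locally bounded for a continuous metric. -/
lemma exists_norm_sq_le_metricForm (x₀ : M) :
    ∃ C > 0, ∀ᶠ z in nhds (extChartAt (𝓡 m) x₀ x₀), ∀ v : EuclideanSpace ℝ (Fin m),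
      ‖v‖ ^ 2 ≤ C * metricForm ((extChartAt (𝓡 m) x₀).symm z)
        (chartSymmDeriv x₀ z v) (chartSymmDeriv x₀ z v) := by
  have : IsContinuousRiemannianBundle (EuclideanSpace ℝ (Fin m))
      (fun x : M => TangentSpace (𝓡 m) x) := by
    obtain ⟨g, hg, hg'⟩ := IsContMDiffRiemannianBundle.exists_contMDiff (IB := 𝓡 m) (n := ∞)
      (F := EuclideanSpace ℝ (Fin m)) (E := fun x : M => TangentSpace (𝓡 m) x)
    exact ⟨g, hg.continuous, hg'⟩
  obtain ⟨C, hC, h⟩ := eventually_norm_trivializationAt_lt (EuclideanSpace ℝ (Fin m))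
    (fun x : M => TangentSpace (𝓡 m) x) x₀
  refine ⟨C ^ 2, by positivity, ?_⟩
  have h1 := (continuousAt_extChartAt_symm (I := 𝓡 m) x₀).eventually
    (p := fun y => ‖(trivializationAt (EuclideanSpace ℝ (Fin m))
      (fun x : M => TangentSpace (𝓡 m) x) x₀).continuousLinearMapAt ℝ y‖ < C) (by simpa using h)
  filter_upwards [h1, extChartAt_target_mem_nhds (I := 𝓡 m) x₀] with z hz hzt v
  have hy := (extChartAt (𝓡 m) x₀).map_target hzt
  have h2 := mfderiv_comp_chartSymmDeriv x₀ hy v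
  rw [(extChartAt (𝓡 m) x₀).right_inv hzt] at h2
  rw [metricForm_self, ← mul_pow]
  have h3 := ContinuousLinearMap.le_of_opNorm_le _ hz.le
    (show TangentSpace (𝓡 m) ((extChartAt (𝓡 m) x₀).symm z) from chartSymmDeriv x₀ z v)
  gcongr
  refine le_trans (le_of_eq ?_) h3
  rw [TangentBundle.continuousLinearMapAt_trivializationAt (by simpa using hy)]
  exact congrArg norm h2.symm

omit [IsManifold (𝓡 m) ∞ M] [IsContMDiffRiemannianBundle (𝓡 m) ∞ (EuclideanSpace ℝ (Fin m))
        (fun x : M => TangentSpace (𝓡 m) x)] in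
lemma metricForm_sum_left {ι : Type*} (s : Finset ι) (y : M) (a : ι → ℝ)
    (v : ι → EuclideanSpace ℝ (Fin m)) (w : EuclideanSpace ℝ (Fin m)) :
    metricForm y (∑ i ∈ s, a i • v i) w = ∑ i ∈ s, a i * metricForm y (v i) w := by
  classical
  induction s using Finset.induction_on with
  | empty => simpa using metricForm_smul_left y 0 0 w
  | insert i s hi ih =>
    rw [Finset.sum_insert hi, Finset.sum_insert hi, metricForm_add_left, metricForm_smul_left, ih]

omit [IsManifold (𝓡 m) ∞ M] [IsContMDiffRiemannianBundle (𝓡 m) ∞ (EuclideanSpace ℝ (Fin m))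
        (fun x : M => TangentSpace (𝓡 m) x)] in
/-- The quadratic form of the metric in coordinates. -/
lemma metricForm_chartSymmDeriv (x₀ : M) (z v w : EuclideanSpace ℝ (Fin m)) :
    metricForm ((extChartAt (𝓡 m) x₀).symm z) (chartSymmDeriv x₀ z v) (chartSymmDeriv x₀ z w) =
      ∑ i, ∑ j, v i * w j * gramMatrix m x₀ z i j := by
  have hsum : ∀ u : EuclideanSpace ℝ (Fin m), chartSymmDeriv x₀ z u =
      ∑ i, u i • chartSymmDeriv x₀ z (EuclideanSpace.single i 1) := by
    intro u
    conv_lhs => rw [← (EuclideanSpace.basisFun (Fin m) ℝ).sum_repr u]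
    simp
  rw [hsum v, metricForm_sum_left]
  refine Finset.sum_congr rfl fun i _ => ?_
  rw [hsum w, metricForm_comm, metricForm_sum_left, Finset.mul_sum]
  refine Finset.sum_congr rfl fun j _ => ?_
  rw [metricForm_comm, ← gramMatrix_apply]
  ring

/-- Near `p`, `f` is `K`-Lipschitz and exceeds `f p / 2`, so an increment over distance `2 r s` is
at most `s f z'` once `r` is small relative to `f p / K`. Measuring displacement in units of `r`
absorbs `K` into the radius and leaves the clean factor `1 + s`. -/
lemma exists_ball_le_one_add_mul {E : Type*} [NormedAddCommGroup E] [NormedSpace ℝ E] {f : E → ℝ}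
    {p : E} (hf : ContDiffAt ℝ 1 f p) (hp : 0 < f p) :
    ∃ ε > 0, ∀ r ≤ ε, ∀ z ∈ Metric.ball p r, ∀ z' ∈ Metric.ball p r, ∀ s ≥ 0,
      dist z z' ≤ 2 * r * s → 0 < f z ∧ f z ≤ (1 + s) * f z' := by
  obtain ⟨K, t, ht, hK⟩ := hf.exists_lipschitzOnWith
  have h1 : ∀ᶠ z in nhds p, f p / 2 < f z :=
    hf.continuousAt.eventually_const_lt (by linarith)
  obtain ⟨ε, hε, hball⟩ := Metric.mem_nhds_iff.1 (Filter.inter_mem ht h1)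
  refine ⟨min ε (f p / (4 * (K + 1))), by positivity, fun r hr z hz z' hz' s hs hd => ?_⟩
  have hz1 := hball (Metric.ball_subset_ball (hr.trans (min_le_left _ _)) hz)
  have hz1' := hball (Metric.ball_subset_ball (hr.trans (min_le_left _ _)) hz')
  have h2 : f p / 2 < f z := hz1.2
  have h2' : f p / 2 < f z' := hz1'.2
  have h3 := hK.dist_le_mul z hz1.1 z' hz1'.1
  rw [Real.dist_eq] at h3
  have h4 : r * (4 * (K + 1)) ≤ f p := (le_div_iff₀ (by positivity)).1 (hr.trans (min_le_right _ _))
  have hr0 : 0 < r := Metric.pos_of_mem_ball hz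
  have h5 : (K : ℝ) * dist z z' ≤ s * f z' := by
    calc (K : ℝ) * dist z z' ≤ K * (2 * r * s) := by gcongr
      _ = s * (r * (2 * K)) := by ring
      _ ≤ s * f z' := by
        gcongr
        nlinarith [K.coe_nonneg]
  exact ⟨by linarith, by linarith [le_abs_self (f z - f z')]⟩

lemma sqrt_le_one_add_mul_sqrt {a b s : ℝ} (hs : 0 ≤ s) (h : a ≤ (1 + s) * b) :
    √a ≤ (1 + s) * √b := by
  have h1 : √(1 + s) ≤ 1 + s := by
    rw [Real.sqrt_le_left (by linarith)]
    nlinarith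
  calc √a ≤ √((1 + s) * b) := Real.sqrt_le_sqrt h
    _ = √(1 + s) * √b := Real.sqrt_mul (by linarith) _
    _ ≤ _ := by gcongr

lemma exists_ball_metricForm_le (x₀ : M) :
    ∃ ε > 0, ∀ r ≤ ε, ∀ z ∈ Metric.ball (extChartAt (𝓡 m) x₀ x₀) r,
      ∀ z' ∈ Metric.ball (extChartAt (𝓡 m) x₀ x₀) r, ∀ s ≥ 0, dist z z' ≤ 2 * r * s →
      ∀ v, metricForm ((extChartAt (𝓡 m) x₀).symm z) (chartSymmDeriv x₀ z v)
          (chartSymmDeriv x₀ z v) ≤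
        (1 + s) * metricForm ((extChartAt (𝓡 m) x₀).symm z') (chartSymmDeriv x₀ z' v)
          (chartSymmDeriv x₀ z' v) := by
  set p := extChartAt (𝓡 m) x₀ x₀
  have hT : (extChartAt (𝓡 m) x₀).target ∈ nhds p := extChartAt_target_mem_nhds (I := 𝓡 m) x₀
  have hL : ∀ i j, ∃ K : ℝ≥0, ∃ t ∈ nhds p,
      LipschitzOnWith K (fun z => gramMatrix m x₀ z i j) t := fun i j =>
    ((contDiffOn_gramMatrix x₀ i j).contDiffAt hT).exists_lipschitzOnWith
  choose K t ht hK using hL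
  obtain ⟨C, hC, hlow⟩ := exists_norm_sq_le_metricForm (m := m) x₀
  have hmem : (⋂ i, ⋂ j, t i j) ∈ nhds p :=
    Filter.iInter_mem.2 fun i => Filter.iInter_mem.2 fun j => ht i j
  obtain ⟨ε, hε, hball⟩ := Metric.mem_nhds_iff.1 (Filter.inter_mem hmem hlow)
  set L : ℝ := ∑ i, ∑ j, (K i j : ℝ) with hLdef
  have hL0 : 0 ≤ L := Finset.sum_nonneg fun i _ => Finset.sum_nonneg fun j _ => (K i j).coe_nonneg
  -- Chosen so that the Lipschitz error `L (2 r s) ‖v‖²`, with `‖v‖² ≤ C Q'`, is at most `s Q'`.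
  refine ⟨min ε (1 / (2 * (L + 1) * C)), by positivity, fun r hr z hz z' hz' s hs hd v => ?_⟩
  have hz1 := hball (Metric.ball_subset_ball (hr.trans (min_le_left _ _)) hz)
  have hz1' := hball (Metric.ball_subset_ball (hr.trans (min_le_left _ _)) hz')
  have hr0 : 0 < r := Metric.pos_of_mem_ball hz
  have hlow' := hz1'.2 v
  rw [metricForm_chartSymmDeriv] at hlow' ⊢
  rw [metricForm_chartSymmDeriv]
  set Q' := ∑ i, ∑ j, v i * v j * gramMatrix m x₀ z' i j
  have h1 : ∑ i, ∑ j, v i * v j * gramMatrix m x₀ z i j - Q' ≤ L * dist z z' * ‖v‖ ^ 2 := by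
    rw [← Finset.sum_sub_distrib, hLdef, Finset.sum_mul, Finset.sum_mul]
    refine Finset.sum_le_sum fun i _ => ?_
    rw [← Finset.sum_sub_distrib, Finset.sum_mul, Finset.sum_mul]
    refine Finset.sum_le_sum fun j _ => ?_
    have h2 := (hK i j).dist_le_mul z (mem_iInter₂.1 hz1.1 i j) z' (mem_iInter₂.1 hz1'.1 i j)
    rw [Real.dist_eq] at h2
    have h3 : |v i * v j| ≤ ‖v‖ ^ 2 := by
      rw [abs_mul, sq]
      exact mul_le_mul (PiLp.norm_apply_le v i) (PiLp.norm_apply_le v j) (abs_nonneg _)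
        (norm_nonneg _)
    calc v i * v j * gramMatrix m x₀ z i j - v i * v j * gramMatrix m x₀ z' i j
        = v i * v j * (gramMatrix m x₀ z i j - gramMatrix m x₀ z' i j) := by ring
      _ ≤ |v i * v j| * |gramMatrix m x₀ z i j - gramMatrix m x₀ z' i j| := by
        rw [← abs_mul]; exact le_abs_self _
      _ ≤ ‖v‖ ^ 2 * (K i j * dist z z') := by gcongr
      _ = _ := by ring
  have h4 : r * (2 * (L + 1) * C) ≤ 1 :=
    (le_div_iff₀ (by positivity)).1 (hr.trans (min_le_right _ _))
  have hQ : 0 ≤ Q' := by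
    by_contra hneg
    nlinarith [sq_nonneg ‖v‖, mul_pos hC (neg_pos.2 (not_le.1 hneg))]
  have h5 : L * dist z z' * ‖v‖ ^ 2 ≤ s * Q' := by
    calc L * dist z z' * ‖v‖ ^ 2 ≤ (L + 1) * (2 * r * s) * (C * Q') := by gcongr; linarith
      _ = (r * (2 * (L + 1) * C)) * (s * Q') := by ring
      _ ≤ 1 * (s * Q') := by gcongr
      _ = s * Q' := one_mul _
  linarith

lemma det_gramMatrix_pos (x₀ : M) : 0 < (gramMatrix m x₀ (extChartAt (𝓡 m) x₀ x₀)).det := by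
  obtain ⟨C, hC, h⟩ := exists_norm_sq_le_metricForm (m := m) x₀
  have h := h.self_of_nhds
  apply Matrix.PosDef.det_pos
  refine Matrix.PosDef.of_dotProduct_mulVec_pos ?_ fun v hv => ?_
  · ext i j
    simp only [Matrix.conjTranspose_apply, star_trivial, gramMatrix_apply]
    exact metricForm_comm _ _ _
  · have h1 := h (WithLp.toLp 2 v)
    rw [metricForm_chartSymmDeriv] at h1
    have h2 : 0 < ‖WithLp.toLp 2 v‖ := norm_pos_iff.2 fun h0 => hv (by simpa using h0)
    have h3 : 0 < C * ∑ i, ∑ j, v i * v j * gramMatrix m x₀ (extChartAt (𝓡 m) x₀ x₀) i j :=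
      lt_of_lt_of_le (by positivity) h1
    have h4 := pos_of_mul_pos_right h3 hC.le
    refine lt_of_lt_of_eq h4 ?_
    simp only [star_trivial, dotProduct, Matrix.mulVec, Finset.mul_sum]
    exact Finset.sum_congr rfl fun i _ => Finset.sum_congr rfl fun j _ => by ring

lemma contDiffOn_det_gramMatrix (x₀ : M) :
    ContDiffOn ℝ 1 (fun z => (gramMatrix m x₀ z).det) (extChartAt (𝓡 m) x₀).target := by
  simp only [Matrix.det_apply']
  exact ContDiffOn.sum fun σ _ => contDiffOn_const.mul
    (contDiffOn_prod fun i _ => contDiffOn_gramMatrix x₀ _ _)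

/-- The metric changes little along contractions of the ball of radius `r` around the centre of
the chart. -/
def MetricComparison (x₀ : M) (r : ℝ) : Prop :=
  Metric.ball (extChartAt (𝓡 m) x₀ x₀) r ⊆ (extChartAt (𝓡 m) x₀).target ∧
      ∀ z ∈ Metric.ball (extChartAt (𝓡 m) x₀ x₀) r,
      ∀ z' ∈ Metric.ball (extChartAt (𝓡 m) x₀ x₀) r, ∀ s ≥ 0, dist z z' ≤ 2 * r * s →
      (∀ v, metricForm ((extChartAt (𝓡 m) x₀).symm z) (chartSymmDeriv x₀ z v)
          (chartSymmDeriv x₀ z v) ≤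
        (1 + s) * metricForm ((extChartAt (𝓡 m) x₀).symm z') (chartSymmDeriv x₀ z' v)
          (chartSymmDeriv x₀ z' v)) ∧
      √(gramMatrix m x₀ z).det ≤ (1 + s) * √(gramMatrix m x₀ z').det

lemma exists_metricComparison (x₀ : M) : ∃ r > 0, MetricComparison (m := m) x₀ r := by
  have hT := extChartAt_target_mem_nhds (I := 𝓡 m) x₀
  obtain ⟨ε₁, hε₁, h1⟩ := exists_ball_metricForm_le (m := m) x₀
  obtain ⟨ε₂, hε₂, h2⟩ := exists_ball_le_one_add_mul
    ((contDiffOn_det_gramMatrix x₀).contDiffAt hT) (det_gramMatrix_pos x₀)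
  obtain ⟨ε₃, hε₃, h3⟩ := Metric.mem_nhds_iff.1 hT
  refine ⟨min ε₁ (min ε₂ ε₃), by positivity,
    (Metric.ball_subset_ball ((min_le_right _ _).trans (min_le_right _ _))).trans h3,
    fun z hz z' hz' s hs hd => ⟨h1 _ (min_le_left _ _) z hz z' hz' s hs hd, ?_⟩⟩
  exact sqrt_le_one_add_mul_sqrt hs
    (h2 _ ((min_le_right _ _).trans (min_le_left _ _)) z hz z' hz' s hs hd).2

end ChartMetric

/-! ### Contractions towards a point in a chart -/

section Contraction

variable {m : ℕ} {M : Type*}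

/-- The contraction of a vector space towards `p` with ratio `1 - s`. -/
def contraction {E : Type*} [AddCommGroup E] [Module ℝ E] (p : E) (s : ℝ) (z : E) : E :=
  p + (1 - s) • (z - p)

lemma contraction_mem_ball {E : Type*} [NormedAddCommGroup E] [NormedSpace ℝ E] {p q z : E}
    {r s : ℝ} (hs : 0 ≤ s) (hs1 : s ≤ 1) (hp : p ∈ Metric.ball q r) (hz : z ∈ Metric.ball q r) :
    contraction p s z ∈ Metric.ball q r := by
  have h := (convex_ball q r) hp hz hs (sub_nonneg.2 hs1) (by ring)
  convert h using 1
  simp only [contraction, smul_sub, sub_smul, one_smul]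
  abel

/-- This is the origin of the displacement `2 * r * s` in `MetricComparison`. -/
lemma dist_contraction_le {E : Type*} [NormedAddCommGroup E] [NormedSpace ℝ E] {p q z : E}
    {r s : ℝ} (hs : 0 ≤ s) (hp : p ∈ Metric.ball q r) (hz : z ∈ Metric.ball q r) :
    dist (contraction p s z) z ≤ 2 * r * s := by
  have h1 : contraction p s z - z = s • (p - z) := by
    simp only [contraction, smul_sub, sub_smul, one_smul]
    abel
  rw [dist_eq_norm, h1, norm_smul, Real.norm_of_nonneg hs, ← dist_eq_norm, mul_comm]
  gcongr
  have := dist_triangle_right p z q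
  rw [Metric.mem_ball] at hp hz
  linarith

lemma hasFDerivAt_contraction {E : Type*} [NormedAddCommGroup E] [NormedSpace ℝ E] (p : E) (s : ℝ)
    (z : E) :
    HasFDerivAt (contraction p s) ((1 - s) • ContinuousLinearMap.id ℝ E) z :=
  (((hasFDerivAt_id z).sub_const p).const_smul (1 - s)).const_add p

section Topological

variable [TopologicalSpace M] [ChartedSpace (EuclideanSpace ℝ (Fin m)) M] [IsManifold (𝓡 m) ∞ M]

/-- The contraction towards `p` in the chart around `x₀`. -/
noncomputable def chartContraction (x₀ : M) (p : EuclideanSpace ℝ (Fin m)) (s : ℝ) (y : M) : M :=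
  (extChartAt (𝓡 m) x₀).symm (contraction p s (extChartAt (𝓡 m) x₀ y))

lemma hasMFDerivAt_chartContraction {x₀ : M} {p : EuclideanSpace ℝ (Fin m)} {s : ℝ} {y : M}
    (hy : y ∈ (extChartAt (𝓡 m) x₀).source)
    (hz : contraction p s (extChartAt (𝓡 m) x₀ y) ∈ (extChartAt (𝓡 m) x₀).target) :
    HasMFDerivAt (𝓡 m) (𝓡 m) (chartContraction x₀ p s) y
      ((chartSymmDeriv x₀ (contraction p s (extChartAt (𝓡 m) x₀ y))).comp
        (((1 - s) • ContinuousLinearMap.id ℝ (EuclideanSpace ℝ (Fin m))).comp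
          (mfderiv (𝓡 m) 𝓘(ℝ, EuclideanSpace ℝ (Fin m)) (extChartAt (𝓡 m) x₀) y :
            EuclideanSpace ℝ (Fin m) →L[ℝ] EuclideanSpace ℝ (Fin m)))) := by
  have h1 : HasMFDerivAt (𝓡 m) 𝓘(ℝ, EuclideanSpace ℝ (Fin m)) (extChartAt (𝓡 m) x₀) y
      (mfderiv (𝓡 m) 𝓘(ℝ, EuclideanSpace ℝ (Fin m)) (extChartAt (𝓡 m) x₀) y) :=
    (mdifferentiableAt_extChartAt (by simpa using hy)).hasMFDerivAt
  have h2 := (hasFDerivAt_contraction p s (extChartAt (𝓡 m) x₀ y)).hasMFDerivAt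
  have h3 : HasMFDerivAt 𝓘(ℝ, EuclideanSpace ℝ (Fin m)) (𝓡 m) (extChartAt (𝓡 m) x₀).symm
      (contraction p s (extChartAt (𝓡 m) x₀ y))
      (mfderiv 𝓘(ℝ, EuclideanSpace ℝ (Fin m)) (𝓡 m) (extChartAt (𝓡 m) x₀).symm
        (contraction p s (extChartAt (𝓡 m) x₀ y))) := by
    have := mdifferentiableWithinAt_extChartAt_symm (I := 𝓡 m) hz
    rw [ModelWithCorners.range_eq_univ, mdifferentiableWithinAt_univ] at this
    exact this.hasMFDerivAt
  exact h3.comp y (h2.comp y h1)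

lemma contMDiffOn_chartContraction {x₀ : M} {p : EuclideanSpace ℝ (Fin m)} {s : ℝ} {U : Set M}
    (hU : U ⊆ (extChartAt (𝓡 m) x₀).source)
    (hz : ∀ y ∈ U, contraction p s (extChartAt (𝓡 m) x₀ y) ∈ (extChartAt (𝓡 m) x₀).target) :
    ContMDiffOn (𝓡 m) (𝓡 m) 1 (chartContraction x₀ p s) U := by
  have h1 : ContMDiffOn (𝓡 m) 𝓘(ℝ, EuclideanSpace ℝ (Fin m)) 1 (extChartAt (𝓡 m) x₀) U :=
    (contMDiffOn_extChartAt (I := 𝓡 m) (x := x₀) (n := 1)).mono (by simpa using hU)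
  have h2 : ContMDiff 𝓘(ℝ, EuclideanSpace ℝ (Fin m)) 𝓘(ℝ, EuclideanSpace ℝ (Fin m)) 1
      (contraction p s) := by
    rw [contMDiff_iff_contDiff]
    unfold contraction
    fun_prop
  exact (contMDiffOn_extChartAt_symm (I := 𝓡 m) x₀).comp (h2.comp_contMDiffOn h1) hz

end Topological

variable [MetricSpace M] [ChartedSpace (EuclideanSpace ℝ (Fin m)) M] [IsManifold (𝓡 m) ∞ M]
  [RiemannianBundle (fun x : M => TangentSpace (𝓡 m) x)]

/-- In coordinates the differential is multiplication by `1 - s`, and moving the base point changes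
squared lengths by at most `1 + s`; finally `(1 - s)² (1 + s) ≤ (1 - s / 2)²`. -/
lemma norm_mfderiv_chartContraction_le {x₀ : M} {r : ℝ} (H : MetricComparison (m := m) x₀ r)
    {p : EuclideanSpace ℝ (Fin m)} (hp : p ∈ Metric.ball (extChartAt (𝓡 m) x₀ x₀) r)
    {s : ℝ} (hs : 0 ≤ s) (hs1 : s ≤ 1) {y : M} (hy : y ∈ (extChartAt (𝓡 m) x₀).source)
    (hyr : extChartAt (𝓡 m) x₀ y ∈ Metric.ball (extChartAt (𝓡 m) x₀ x₀) r)
    (w : TangentSpace (𝓡 m) y) :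
    ‖mfderiv (𝓡 m) (𝓡 m) (chartContraction x₀ p s) y w‖ ≤ (1 - s / 2) * ‖w‖ := by
  have hc := contraction_mem_ball hs hs1 hp hyr
  rw [(hasMFDerivAt_chartContraction hy (H.1 hc)).mfderiv]
  set z := extChartAt (𝓡 m) x₀ y with hz
  set v : EuclideanSpace ℝ (Fin m) := (mfderiv (𝓡 m) 𝓘(ℝ, EuclideanSpace ℝ (Fin m))
    (extChartAt (𝓡 m) x₀) y : EuclideanSpace ℝ (Fin m) →L[ℝ] EuclideanSpace ℝ (Fin m)) w with hv
  have h1 := (H.2 _ hc z hyr s hs (dist_contraction_le hs hp hyr)).1 v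
  have h2 : chartSymmDeriv x₀ z v = w := chartSymmDeriv_comp_mfderiv x₀ hy w
  rw [h2, (extChartAt (𝓡 m) x₀).left_inv hy] at h1
  have h3 : ‖w‖ ^ 2 = metricForm y w w := (metricForm_self y w).symm
  refine abs_le_of_sq_le_sq' ?_ (mul_nonneg (by linarith) (norm_nonneg _)) |>.2
  rw [mul_pow, h3]
  set c := contraction p s z
  change ‖(show TangentSpace (𝓡 m) ((extChartAt (𝓡 m) x₀).symm c) from
    chartSymmDeriv x₀ c ((1 - s) • v))‖ ^ 2 ≤ _
  rw [← metricForm_self, map_smul, metricForm_smul_left, metricForm_comm, metricForm_smul_left]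
  have h4 : 0 ≤ metricForm y w w := by rw [← h3]; positivity
  calc (1 - s) * ((1 - s) * metricForm ((extChartAt (𝓡 m) x₀).symm c) (chartSymmDeriv x₀ c v)
        (chartSymmDeriv x₀ c v)) ≤ (1 - s) * ((1 - s) * ((1 + s) * metricForm y w w)) := by
        gcongr
    _ = ((1 - s) * (1 - s) * (1 + s)) * metricForm y w w := by ring
    _ ≤ (1 - s / 2) ^ 2 * metricForm y w w := by
        gcongr
        nlinarith [mul_nonneg hs (sub_nonneg.2 hs1), mul_nonneg hs hs]

/-- The contraction fixes `x` and shortens every tangent vector, hence it shortens an almost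
minimizing curve from `x` to `y`. -/
lemma dist_chartContraction_le [IsRiemannianManifold (𝓡 m) M] {x₀ : M} {r : ℝ}
    (H : MetricComparison (m := m) x₀ r)
    {x y : M} {R : ℝ} (hR : ∀ y ∈ Metric.ball x R, y ∈ (extChartAt (𝓡 m) x₀).source ∧
      extChartAt (𝓡 m) x₀ y ∈ Metric.ball (extChartAt (𝓡 m) x₀ x₀) r)
    {s : ℝ} (hs : 0 ≤ s) (hs1 : s ≤ 1) (hy : y ∈ Metric.ball x R) :
    dist x (chartContraction x₀ (extChartAt (𝓡 m) x₀ x) s y) ≤ (1 - s / 2) * dist x y := by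
  have hx : x ∈ Metric.ball x R := Metric.mem_ball_self (Metric.pos_of_mem_ball hy)
  set p := extChartAt (𝓡 m) x₀ x with hp
  have hc0 : 0 ≤ 1 - s / 2 := by linarith
  suffices h : edist x (chartContraction x₀ p s y) ≤ ENNReal.ofReal (1 - s / 2) * edist x y by
    rw [edist_dist, edist_dist, ← ENNReal.ofReal_mul hc0] at h
    exact (ENNReal.ofReal_le_ofReal_iff (by positivity)).1 h
  have hlt : edist x y < ENNReal.ofReal R := by
    rw [edist_comm, edist_dist]
    exact (ENNReal.ofReal_lt_ofReal_iff (Metric.pos_of_mem_ball hy)).2 hy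
  -- Curves of length below `L` avoid any appeal to minimizing geodesics; `L` then decreases to the
  -- distance.
  suffices h : ∀ L, edist x y < L → L < ENNReal.ofReal R →
      edist x (chartContraction x₀ p s y) ≤ ENNReal.ofReal (1 - s / 2) * L by
    by_contra hlt'
    have hc : ENNReal.ofReal (1 - s / 2) ≠ 0 := by
      rw [Ne, ENNReal.ofReal_eq_zero, not_le]
      linarith
    rw [not_le, mul_comm, ← ENNReal.lt_div_iff_mul_lt (Or.inl hc) (Or.inl ENNReal.ofReal_ne_top)]
      at hlt'
    obtain ⟨L, hL1, hL2⟩ := exists_between (lt_min hlt' hlt)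
    have h1 := (ENNReal.lt_div_iff_mul_lt (Or.inl hc) (Or.inl ENNReal.ofReal_ne_top)).1
      (hL2.trans_le (min_le_left _ _))
    rw [mul_comm] at h1
    exact absurd (h L hL1 (hL2.trans_le (min_le_right _ _))) (not_le.2 h1)
  intro L hL hLR
  rw [IsRiemannianManifold.out (I := 𝓡 m)] at hL
  obtain ⟨γ, h0, h1, hγ, hlen⟩ := exists_lt_of_riemannianEDist_lt hL
  have hball : ∀ t ∈ Icc (0 : ℝ) 1, γ t ∈ Metric.ball x R := by
    -- The initial segment up to `t` is shorter than `R`, so the curve never leaves the ball where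
    -- the chart estimates hold.
    intro t ht
    have h2 : edist x (γ t) < ENNReal.ofReal R := by
      rw [IsRiemannianManifold.out (I := 𝓡 m)]
      refine lt_of_le_of_lt ?_ (hlen.trans hLR)
      refine (riemannianEDist_le_pathELength (hγ.mono (Icc_subset_Icc_right ht.2)) h0 rfl
        ht.1).trans ?_
      exact pathELength_mono le_rfl ht.2
    rw [edist_comm, edist_dist] at h2
    exact (ENNReal.ofReal_lt_ofReal_iff (Metric.pos_of_mem_ball hy)).1 h2
  have hcm : ContMDiffOn (𝓡 m) (𝓡 m) 1 (chartContraction x₀ p s) (Metric.ball x R) :=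
    contMDiffOn_chartContraction (fun y hy => (hR y hy).1)
      fun y hy => H.1 (contraction_mem_ball hs hs1 (hR x hx).2 (hR y hy).2)
  have hle : edist x (chartContraction x₀ p s y) ≤
      pathELength (𝓡 m) (chartContraction x₀ p s ∘ γ) 0 1 := by
    rw [IsRiemannianManifold.out (I := 𝓡 m)]
    refine riemannianEDist_le_pathELength (hcm.comp hγ hball) ?_ ?_ zero_le_one
    · rw [Function.comp_apply, h0, chartContraction, contraction, ← hp, sub_self, smul_zero,
        add_zero, hp, (extChartAt (𝓡 m) x₀).left_inv (hR x hx).1]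
    · simp [h1]
  refine hle.trans (le_trans ?_ (mul_le_mul_right hlen.le _))
  rw [pathELength_eq_lintegral_mfderivWithin_Icc, pathELength_eq_lintegral_mfderivWithin_Icc,
    ← lintegral_const_mul' _ _ ENNReal.ofReal_ne_top]
  refine setLIntegral_mono' measurableSet_Icc fun t ht => ?_
  have hdiff := (hasMFDerivAt_chartContraction (hR _ (hball t ht)).1
    (H.1 (contraction_mem_ball hs hs1 (hR x hx).2 (hR _ (hball t ht)).2))).mdifferentiableAt
  rw [mfderiv_comp_mfderivWithin t hdiff (hγ.mdifferentiableOn one_ne_zero t ht)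
    (uniqueMDiffWithinAt_iff_uniqueDiffWithinAt.2 (uniqueDiffOn_Icc zero_lt_one t ht))]
  have hn := norm_mfderiv_chartContraction_le H (hR x hx).2 hs hs1 (hR _ (hball t ht)).1
    (hR _ (hball t ht)).2 (mfderivWithin 𝓘(ℝ, ℝ) (𝓡 m) γ (Icc 0 1) t 1)
  rw [← ofReal_norm, ← ofReal_norm, ← ENNReal.ofReal_mul hc0]
  exact ENNReal.ofReal_le_ofReal hn

end Contraction

/-! ### Riemannian volume in a single chart -/

section VolumeInCharts

variable {m : ℕ} {M : Type*} [TopologicalSpace M] [ChartedSpace (EuclideanSpace ℝ (Fin m)) M]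
  [MeasurableSpace M] [BorelSpace M]

/-- The part of the chart domain that corresponds to `A`. -/
def chartPreimage (x₀ : M) (A : Set M) : Set (EuclideanSpace ℝ (Fin m)) :=
  (extChartAt (𝓡 m) x₀).target ∩ (extChartAt (𝓡 m) x₀).symm ⁻¹' A

lemma measurableSet_chartPreimage (x₀ : M) {A : Set M} (hA : MeasurableSet A) :
    MeasurableSet (chartPreimage (m := m) x₀ A) := by
  have hT : MeasurableSet (extChartAt (𝓡 m) x₀).target :=
    (isOpen_extChartAt_target x₀).measurableSet
  have h := (continuousOn_extChartAt_symm (I := 𝓡 m) x₀).domRestrict.measurable hA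
  convert MeasurableSet.subtype_image hT h using 1
  ext z
  simp [chartPreimage, and_comm]

variable [RiemannianBundle (fun x : M => TangentSpace (𝓡 m) x)]

/-- The volume density `√det(gᵢⱼ)` in the chart around `x₀`. -/
noncomputable def volumeDensity (x₀ : M) (z : EuclideanSpace ℝ (Fin m)) : ℝ≥0∞ :=
  ENNReal.ofReal (√(gramMatrix m x₀ z).det)

lemma chartVolume_apply (x₀ : M) {A : Set M} (hA : MeasurableSet A) :
    chartVolume m x₀ A = ∫⁻ z in chartPreimage (m := m) x₀ A, volumeDensity x₀ z := by
  have hT : MeasurableSet (extChartAt (𝓡 m) x₀).target :=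
    (isOpen_extChartAt_target x₀).measurableSet
  have h1 : AEMeasurable (extChartAt (𝓡 m) x₀).symm
      (volume.restrict (extChartAt (𝓡 m) x₀).target) :=
    (continuousOn_extChartAt_symm (I := 𝓡 m) x₀).aemeasurable hT
  rw [chartVolume, Measure.map_apply_of_aemeasurable
    (h1.mono_ac (withDensity_absolutelyContinuous _ _)) hA, withDensity_apply',
    Measure.restrict_restrict' hT, inter_comm]
  rfl

lemma chartVolume_inter_source (x₀ : M) {A : Set M} (hA : MeasurableSet A) :
    chartVolume m x₀ (A ∩ (extChartAt (𝓡 m) x₀).source) = chartVolume m x₀ A := by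
  rw [chartVolume_apply x₀ (hA.inter (isOpen_extChartAt_source x₀).measurableSet),
    chartVolume_apply x₀ hA]
  congr 2
  ext z
  simp only [chartPreimage, mem_inter_iff, mem_preimage]
  exact ⟨fun h => ⟨h.1, h.2.1⟩, fun h => ⟨h.1, h.2, (extChartAt (𝓡 m) x₀).map_target h.1⟩⟩

/-- The hypothesis says `G₁ = Kᵀ G₀ K` for the matrix `K` of `J`. -/
lemma sqrt_det_eq_abs_det_mul {G₀ G₁ : Matrix (Fin m) (Fin m) ℝ}
    (J : EuclideanSpace ℝ (Fin m) →L[ℝ] EuclideanSpace ℝ (Fin m))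
    (h : ∀ i j, G₁ i j = ∑ k, ∑ l, J (EuclideanSpace.single i 1) k *
      J (EuclideanSpace.single j 1) l * G₀ k l) :
    √G₁.det = |J.det| * √G₀.det := by
  let b := (EuclideanSpace.basisFun (Fin m) ℝ).toBasis
  set K := LinearMap.toMatrix b b (J : EuclideanSpace ℝ (Fin m) →ₗ[ℝ] EuclideanSpace ℝ (Fin m))
  have hK : ∀ k i, K k i = J (EuclideanSpace.single i 1) k := by
    intro k i
    simp [K, b, LinearMap.toMatrix_apply]
  have hG : G₁ = K.transpose * G₀ * K := by
    ext i j
    rw [h, Matrix.mul_apply]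
    simp only [Matrix.mul_apply, Matrix.transpose_apply, hK, Finset.sum_mul]
    rw [Finset.sum_comm]
    exact Finset.sum_congr rfl fun k _ => Finset.sum_congr rfl fun l _ => by ring
  have hdet : J.det = K.det := (LinearMap.det_toMatrix b _).symm
  rw [hG, Matrix.det_mul, Matrix.det_mul, Matrix.det_transpose, hdet,
    show K.det * G₀.det * K.det = K.det ^ 2 * G₀.det by ring, Real.sqrt_mul (sq_nonneg _),
    Real.sqrt_sq_eq_abs]

variable [IsManifold (𝓡 m) ∞ M]

/-- Change of variables along the transition map: its Jacobian is exactly the ratio of the two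
densities. -/
lemma chartVolume_eq_of_subset (x₀ x₁ : M) {A : Set M} (hA : MeasurableSet A)
    (h₀ : A ⊆ (extChartAt (𝓡 m) x₀).source) (h₁ : A ⊆ (extChartAt (𝓡 m) x₁).source) :
    chartVolume m x₁ A = chartVolume m x₀ A := by
  set φ₀ := extChartAt (𝓡 m) x₀
  set φ₁ := extChartAt (𝓡 m) x₁
  have himage : (φ₀ ∘ φ₁.symm) '' chartPreimage x₁ A = chartPreimage x₀ A := by
    ext z
    constructor
    · rintro ⟨w, hw, rfl⟩
      refine ⟨φ₀.map_source (h₀ hw.2), ?_⟩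
      rw [mem_preimage, Function.comp_apply, φ₀.left_inv (h₀ hw.2)]
      exact hw.2
    · intro hz
      refine ⟨φ₁ (φ₀.symm z), ⟨φ₁.map_source (h₁ hz.2), ?_⟩, ?_⟩
      · rw [mem_preimage, φ₁.left_inv (h₁ hz.2)]
        exact hz.2
      · rw [Function.comp_apply, φ₁.left_inv (h₁ hz.2), φ₀.right_inv hz.1]
  have hinj : InjOn (φ₀ ∘ φ₁.symm) (chartPreimage x₁ A) := fun z hz w hw h =>
    φ₁.symm.injOn hz.1 hw.1 (φ₀.injOn (h₀ hz.2) (h₀ hw.2) h)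
  let J : EuclideanSpace ℝ (Fin m) → EuclideanSpace ℝ (Fin m) →L[ℝ] EuclideanSpace ℝ (Fin m) :=
    fun z => (mfderiv (𝓡 m) 𝓘(ℝ, EuclideanSpace ℝ (Fin m)) φ₀ (φ₁.symm z) :
      EuclideanSpace ℝ (Fin m) →L[ℝ] EuclideanSpace ℝ (Fin m)).comp (chartSymmDeriv x₁ z)
  have hJ : ∀ z ∈ chartPreimage x₁ A, HasFDerivWithinAt (φ₀ ∘ φ₁.symm) (J z)
      (chartPreimage x₁ A) z := by
    intro z hz
    apply HasFDerivAt.hasFDerivWithinAt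
    have h2 : HasMFDerivAt (𝓡 m) 𝓘(ℝ, EuclideanSpace ℝ (Fin m)) φ₀ (φ₁.symm z)
        (mfderiv (𝓡 m) 𝓘(ℝ, EuclideanSpace ℝ (Fin m)) φ₀ (φ₁.symm z)) :=
      (mdifferentiableAt_extChartAt
        (by simpa only [φ₀, extChartAt_source] using h₀ hz.2)).hasMFDerivAt
    have h3 := mdifferentiableWithinAt_extChartAt_symm (I := 𝓡 m) hz.1
    rw [ModelWithCorners.range_eq_univ, mdifferentiableWithinAt_univ] at h3
    exact hasMFDerivAt_iff_hasFDerivAt.1 (h2.comp z h3.hasMFDerivAt)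
  rw [chartVolume_apply x₁ hA, chartVolume_apply x₀ hA, ← himage,
    lintegral_image_eq_lintegral_abs_det_fderiv_mul volume (measurableSet_chartPreimage x₁ hA)
      hJ hinj]
  refine setLIntegral_congr_fun (measurableSet_chartPreimage x₁ hA) fun z hz => ?_
  have hJs : ∀ v, chartSymmDeriv x₀ (φ₀ (φ₁.symm z)) (J z v) = chartSymmDeriv x₁ z v := fun v =>
    chartSymmDeriv_comp_mfderiv x₀ (h₀ hz.2) _
  have hdet := sqrt_det_eq_abs_det_mul (G₀ := gramMatrix m x₀ (φ₀ (φ₁.symm z)))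
    (G₁ := gramMatrix m x₁ z) (J z) fun i j => by
      rw [← metricForm_chartSymmDeriv, hJs, hJs, gramMatrix_apply]
      change _ = metricForm (φ₀.symm (φ₀ (φ₁.symm z))) _ _
      rw [φ₀.left_inv (h₀ hz.2)]
  simp only [volumeDensity, Function.comp_apply]
  rw [hdet, ENNReal.ofReal_mul (abs_nonneg _)]

/-- On the domain of the chart around `x₀`, the Riemannian volume is `√det(gᵢⱼ) dx¹⋯dxᵐ`. -/
lemma riemannianVolume_eq_chartVolume (x₀ : M) {A : Set M} (hA : MeasurableSet A)
    (h₀ : A ⊆ (extChartAt (𝓡 m) x₀).source) :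
    riemannianVolume m M A = chartVolume m x₀ A := by
  have hS : ∀ x : M, MeasurableSet (extChartAt (𝓡 m) x).source := fun x =>
    (isOpen_extChartAt_source x).measurableSet
  refine le_antisymm ?_ (Measure.le_iff.1 (le_iSup (fun x => chartVolume m x) x₀) A hA)
  set S := (extChartAt (𝓡 m) x₀).source
  -- A supremum of measures is awkward to evaluate on a set, but easy to bound by one measure. This
  -- one dominates every chart measure: on `S` by the agreement of charts, off `S` because it is the
  -- largest measure there.
  have hle : riemannianVolume m M ≤
      chartVolume m x₀ + (⊤ : Measure M).restrict Sᶜ := by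
    refine iSup_le fun x₁ => Measure.le_iff.2 fun B hB => ?_
    rw [← measure_inter_add_sdiff B (hS x₀), Measure.add_apply]
    refine add_le_add ?_ ?_
    · rw [← chartVolume_inter_source x₁ (hB.inter (hS x₀)),
        chartVolume_eq_of_subset x₀ x₁ ((hB.inter (hS x₀)).inter (hS x₁))
          (inter_subset_left.trans inter_subset_right) inter_subset_right]
      exact measure_mono (inter_subset_left.trans inter_subset_left)
    · rw [Measure.restrict_apply hB, ← sdiff_eq]
      exact Measure.le_iff.1 le_top _ (hB.diff (hS x₀))
  refine (Measure.le_iff.1 hle A hA).trans_eq ?_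
  rw [Measure.add_apply, Measure.restrict_apply hA, ← sdiff_eq, sdiff_eq_empty.2 h₀, measure_empty,
    add_zero]

end VolumeInCharts

/-! ### Volumes of concentric balls -/

section VolumeOfBalls

variable {m : ℕ} {M : Type*} [MetricSpace M] [ChartedSpace (EuclideanSpace ℝ (Fin m)) M]
  [IsManifold (𝓡 m) ∞ M] [RiemannianBundle (fun x : M => TangentSpace (𝓡 m) x)]
  [IsRiemannianManifold (𝓡 m) M] [MeasurableSpace M] [BorelSpace M]

/-- The contraction maps the large ball injectively into the small one, with Jacobian `(1 - s) ^ m`,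
and the volume density changes by at most `1 + s` along it. -/
lemma mul_volume_closedBall_le_of_metricComparison {x₀ : M} {r : ℝ}
    (H : MetricComparison (m := m) x₀ r)
    {x : M} {R : ℝ} (hR : ∀ y ∈ Metric.ball x R, y ∈ (extChartAt (𝓡 m) x₀).source ∧
      extChartAt (𝓡 m) x₀ y ∈ Metric.ball (extChartAt (𝓡 m) x₀ x₀) r)
    {s : ℝ} (hs : 0 ≤ s) (hs1 : s < 1) {t : ℝ} (ht0 : 0 ≤ t) (ht : t < R) :
    ENNReal.ofReal ((1 - s) ^ m) * riemannianVolume m M (Metric.closedBall x t) ≤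
      ENNReal.ofReal (1 + s) * riemannianVolume m M (Metric.closedBall x ((1 - s / 2) * t)) := by
  set φ := extChartAt (𝓡 m) x₀
  have hsub : Metric.closedBall x t ⊆ Metric.ball x R := Metric.closedBall_subset_ball ht
  have hsub' : Metric.closedBall x ((1 - s / 2) * t) ⊆ Metric.closedBall x t :=
    Metric.closedBall_subset_closedBall (by nlinarith)
  rw [riemannianVolume_eq_chartVolume x₀ Metric.isClosed_closedBall.measurableSet
      fun y hy => (hR y (hsub hy)).1,
    riemannianVolume_eq_chartVolume x₀ Metric.isClosed_closedBall.measurableSet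
      fun y hy => (hR y (hsub (hsub' hy))).1,
    chartVolume_apply x₀ Metric.isClosed_closedBall.measurableSet,
    chartVolume_apply x₀ Metric.isClosed_closedBall.measurableSet]
  have hx : x ∈ Metric.ball x R := Metric.mem_ball_self (ht0.trans_lt ht)
  set p := φ x
  have hT := measurableSet_chartPreimage (m := m) x₀
    (Metric.isClosed_closedBall (x := x) (ε := t)).measurableSet
  set T := chartPreimage (m := m) x₀ (Metric.closedBall x t) with hTdef
  have hmem : ∀ z ∈ T, z ∈ Metric.ball (φ x₀) r := by
    intro z hz
    rw [← φ.right_inv hz.1]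
    exact (hR _ (hsub hz.2)).2
  have himage : contraction p s '' T ⊆
      chartPreimage x₀ (Metric.closedBall x ((1 - s / 2) * t)) := by
    rintro _ ⟨z, hz, rfl⟩
    refine ⟨H.1 (contraction_mem_ball hs hs1.le (hR x hx).2 (hmem z hz)), ?_⟩
    have h := dist_chartContraction_le H hR hs hs1.le (hsub hz.2)
    rw [chartContraction, φ.right_inv hz.1] at h
    rw [mem_preimage, Metric.mem_closedBall']
    refine h.trans (mul_le_mul_of_nonneg_left (Metric.mem_closedBall'.1 hz.2) (by linarith))
  have hinj : InjOn (contraction p s) T := fun z _ w _ h => by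
    have h1 := smul_right_injective _ (sub_ne_zero.2 hs1.ne') (add_left_cancel h)
    exact sub_left_injective h1
  have hdet : ((1 - s) • ContinuousLinearMap.id ℝ (EuclideanSpace ℝ (Fin m))).det =
      (1 - s) ^ m := by
    rw [ContinuousLinearMap.det, ContinuousLinearMap.toLinearMap_smul, LinearMap.det_smul]
    simp
  calc ENNReal.ofReal ((1 - s) ^ m) * ∫⁻ z in T, volumeDensity x₀ z
      = ∫⁻ z in T, ENNReal.ofReal ((1 - s) ^ m) * volumeDensity x₀ z :=
        (lintegral_const_mul' _ _ ENNReal.ofReal_ne_top).symm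
    _ ≤ ∫⁻ z in T, ENNReal.ofReal (1 + s) *
          (ENNReal.ofReal |((1 - s) • ContinuousLinearMap.id ℝ (EuclideanSpace ℝ (Fin m))).det| *
            volumeDensity x₀ (contraction p s z)) := by
        refine setLIntegral_mono' hT fun z hz => ?_
        rw [hdet, abs_of_nonneg (pow_nonneg (by linarith) m), mul_left_comm]
        gcongr
        rw [volumeDensity, volumeDensity, ← ENNReal.ofReal_mul (by linarith)]
        refine ENNReal.ofReal_le_ofReal (H.2 _ (hmem z hz) _
          (contraction_mem_ball hs hs1.le (hR x hx).2 (hmem z hz)) s hs ?_).2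
        rw [dist_comm]
        exact dist_contraction_le hs (hR x hx).2 (hmem z hz)
    _ = ENNReal.ofReal (1 + s) * ∫⁻ z in contraction p s '' T, volumeDensity x₀ z := by
        rw [lintegral_const_mul' _ _ ENNReal.ofReal_ne_top,
          lintegral_image_eq_lintegral_abs_det_fderiv_mul volume hT
            (fun z _ => (hasFDerivAt_contraction p s z).hasFDerivWithinAt) hinj]
    _ ≤ _ := by gcongr

variable [IsContMDiffRiemannianBundle (𝓡 m) ∞ (EuclideanSpace ℝ (Fin m))
        (fun x : M => TangentSpace (𝓡 m) x)] [CompactSpace M]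

variable (m M) in
/-- A local doubling property of the Riemannian volume of a compact manifold, sharp up to absolute
constants for balls of almost equal radius. -/
lemma exists_forall_mul_volume_closedBall_le :
    ∃ R > 0, ∀ (x : M) (s t : ℝ), 0 ≤ s → s < 1 → 0 ≤ t → t < R →
      ENNReal.ofReal ((1 - s) ^ m) * riemannianVolume m M (Metric.closedBall x t) ≤
      ENNReal.ofReal (1 + s) * riemannianVolume m M (Metric.closedBall x ((1 - s / 2) * t)) := by
  choose r hr H using exists_metricComparison (m := m) (M := M)
  -- A Lebesgue number of the cover by good chart balls is a radius valid at every centre.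
  obtain ⟨R, hR, h⟩ := lebesgue_number_lemma_of_metric (isCompact_univ (X := M))
    (c := fun x₀ => (extChartAt (𝓡 m) x₀).source ∩
      extChartAt (𝓡 m) x₀ ⁻¹' Metric.ball (extChartAt (𝓡 m) x₀ x₀) (r x₀))
    (fun x₀ => (continuousOn_extChartAt x₀).isOpen_inter_preimage (isOpen_extChartAt_source x₀)
      Metric.isOpen_ball)
    (fun x₀ _ => mem_iUnion.2 ⟨x₀, mem_extChartAt_source x₀, Metric.mem_ball_self (hr x₀)⟩)
  refine ⟨R, hR, fun x s t hs hs1 ht0 ht => ?_⟩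
  obtain ⟨x₀, hx₀⟩ := h x (mem_univ x)
  exact mul_volume_closedBall_le_of_metricComparison (H x₀) (fun y hy => hx₀ hy) hs hs1 ht0 ht

end VolumeOfBalls

/-! ### Masses of balls for a Lipschitz density -/

section Density

variable {m : ℕ} {M : Type*} [MetricSpace M] [ChartedSpace (EuclideanSpace ℝ (Fin m)) M]
  [RiemannianBundle (fun x : M => TangentSpace (𝓡 m) x)] [MeasurableSpace M] [BorelSpace M]

lemma densityMeasure_closedBall_le {ρ : M → ℝ} {L : ℝ} (hL : 0 ≤ L)
    (hρL : ∀ x y, |ρ x - ρ y| ≤ L * dist x y) (x : M) (t : ℝ) :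
    densityMeasure m ρ (Metric.closedBall x t) ≤
      ENNReal.ofReal (ρ x + L * t) * riemannianVolume m M (Metric.closedBall x t) := by
  rw [densityMeasure, withDensity_apply _ Metric.isClosed_closedBall.measurableSet,
    ← setLIntegral_const]
  refine setLIntegral_mono' Metric.isClosed_closedBall.measurableSet fun y hy => ?_
  refine ENNReal.ofReal_le_ofReal ?_
  have h1 := hρL y x
  have h2 : L * dist y x ≤ L * t := mul_le_mul_of_nonneg_left hy hL
  linarith [le_abs_self (ρ y - ρ x)]

lemma le_densityMeasure_closedBall {ρ : M → ℝ} {L : ℝ} (hL : 0 ≤ L)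
    (hρL : ∀ x y, |ρ x - ρ y| ≤ L * dist x y) (x : M) (t : ℝ) :
    ENNReal.ofReal (ρ x - L * t) * riemannianVolume m M (Metric.closedBall x t) ≤
      densityMeasure m ρ (Metric.closedBall x t) := by
  rw [densityMeasure, withDensity_apply _ Metric.isClosed_closedBall.measurableSet,
    ← setLIntegral_const]
  refine setLIntegral_mono' Metric.isClosed_closedBall.measurableSet fun y hy => ?_
  refine ENNReal.ofReal_le_ofReal ?_
  have h1 := hρL x y
  have h2 : L * dist x y ≤ L * t :=
    mul_le_mul_of_nonneg_left (Metric.mem_closedBall'.1 hy) hL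
  linarith [le_abs_self (ρ x - ρ y)]

/-- Masses of concentric balls of almost equal radius, for a measure with Lipschitz density. -/
lemma real_densityMeasure_closedBall_le {ρ : M → ℝ} {β L : ℝ} (hβ : 0 < β) (hL : 0 ≤ L)
    (hρ : ∀ x, 1 / β ≤ ρ x) (hρL : ∀ x y, |ρ x - ρ y| ≤ L * dist x y)
    [IsProbabilityMeasure (densityMeasure m ρ)] {x : M} {s t : ℝ} (hs : 0 ≤ s) (hs1 : s < 1)
    (ht : 0 ≤ t) (hq : β * L * t ≤ 1)
    (hvol : ENNReal.ofReal ((1 - s) ^ m) * riemannianVolume m M (Metric.closedBall x t) ≤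
      ENNReal.ofReal (1 + s) * riemannianVolume m M (Metric.closedBall x ((1 - s / 2) * t))) :
    (1 - s) ^ m * (1 - β * L * t) * (densityMeasure m ρ).real (Metric.closedBall x t) ≤
      (1 + s) * (1 + β * L * t) *
        (densityMeasure m ρ).real (Metric.closedBall x ((1 - s / 2) * t)) := by
  set q := β * L * t with hqdef
  have hq0 : 0 ≤ q := by positivity
  have ha := hρ x
  have ha0 : 0 < ρ x := lt_of_lt_of_le (by positivity) ha
  -- The lower bound `1 / β ≤ ρ x` turns the absolute oscillation `L t` into the relative error `q`.
  have hLt : L * t ≤ q * ρ x := by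
    calc L * t = q * (1 / β) := by rw [hqdef]; field_simp
      _ ≤ q * ρ x := by gcongr
  set r := (1 - s / 2) * t
  have hr : L * r ≤ L * t := mul_le_mul_of_nonneg_left (mul_le_of_le_one_left ht (by linarith)) hL
  set Vt := riemannianVolume m M (Metric.closedBall x t)
  set Vr := riemannianVolume m M (Metric.closedBall x r)
  have h1s : 0 ≤ (1 - s) ^ m := pow_nonneg (by linarith) m
  have h1q : 0 ≤ 1 - q := by linarith
  have hup : densityMeasure m ρ (Metric.closedBall x t) ≤ ENNReal.ofReal ((1 + q) * ρ x) * Vt := by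
    refine (densityMeasure_closedBall_le hL hρL x t).trans ?_
    gcongr
    linarith
  have hlow : ENNReal.ofReal ((1 - q) * ρ x) * Vr ≤ densityMeasure m ρ (Metric.closedBall x r) := by
    refine le_trans ?_ (le_densityMeasure_closedBall hL hρL x r)
    gcongr
    linarith
  -- Both masses are compared through the common factor `(1 - q) (1 + q) ρ x`, so no division is
  -- needed.
  have key : ENNReal.ofReal ((1 - s) ^ m * (1 - q)) * densityMeasure m ρ (Metric.closedBall x t) ≤
      ENNReal.ofReal ((1 + s) * (1 + q)) * densityMeasure m ρ (Metric.closedBall x r) := by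
    have e1 : ENNReal.ofReal ((1 - s) ^ m * (1 - q)) * ENNReal.ofReal ((1 + q) * ρ x) =
        ENNReal.ofReal ((1 - q) * ((1 + q) * ρ x)) * ENNReal.ofReal ((1 - s) ^ m) := by
      rw [← ENNReal.ofReal_mul (by positivity), ← ENNReal.ofReal_mul (by positivity)]
      ring_nf
    have e2 : ENNReal.ofReal ((1 - q) * ((1 + q) * ρ x)) * ENNReal.ofReal (1 + s) =
        ENNReal.ofReal ((1 + s) * (1 + q)) * ENNReal.ofReal ((1 - q) * ρ x) := by
      rw [← ENNReal.ofReal_mul (by positivity), ← ENNReal.ofReal_mul (by positivity)]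
      ring_nf
    calc _ ≤ ENNReal.ofReal ((1 - s) ^ m * (1 - q)) * (ENNReal.ofReal ((1 + q) * ρ x) * Vt) := by
          gcongr
      _ = ENNReal.ofReal ((1 - q) * ((1 + q) * ρ x)) * (ENNReal.ofReal ((1 - s) ^ m) * Vt) := by
          rw [← mul_assoc, e1, mul_assoc]
      _ ≤ ENNReal.ofReal ((1 - q) * ((1 + q) * ρ x)) * (ENNReal.ofReal (1 + s) * Vr) := by gcongr
      _ = ENNReal.ofReal ((1 + s) * (1 + q)) * (ENNReal.ofReal ((1 - q) * ρ x) * Vr) := by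
          rw [← mul_assoc, e2, mul_assoc]
      _ ≤ _ := by gcongr
  have h := ENNReal.toReal_mono (ENNReal.mul_ne_top ENNReal.ofReal_ne_top (measure_ne_top _ _)) key
  rw [ENNReal.toReal_mul, ENNReal.toReal_mul, ENNReal.toReal_ofReal (by positivity),
    ENNReal.toReal_ofReal (by positivity)] at h
  exact h

-- In positive dimension a chart supplies two distinct points, and the Lipschitz bound between them
-- forces the sign.
omit [RiemannianBundle (fun x : M => TangentSpace (𝓡 m) x)] [MeasurableSpace M] [BorelSpace M] in
lemma lipschitz_const_nonneg [Nonempty M] [IsManifold (𝓡 m) ∞ M] (hm : 1 ≤ m) {ρ : M → ℝ} {L : ℝ}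
    (hρL : ∀ x y, |ρ x - ρ y| ≤ L * dist x y) : 0 ≤ L := by
  obtain ⟨x₀⟩ := ‹Nonempty M›
  have : Nonempty (Fin m) := ⟨⟨0, hm⟩⟩
  have hT := extChartAt_target_mem_nhds (I := 𝓡 m) x₀
  have hne : (nhdsWithin (extChartAt (𝓡 m) x₀ x₀) {extChartAt (𝓡 m) x₀ x₀}ᶜ).NeBot :=
    Module.punctured_nhds_neBot ℝ _ _
  obtain ⟨z, hz, hz'⟩ := hne.nonempty_of_mem
    (Filter.inter_mem (mem_nhdsWithin_of_mem_nhds hT) self_mem_nhdsWithin)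
  have hd : 0 < dist x₀ ((extChartAt (𝓡 m) x₀).symm z) := by
    rw [dist_pos]
    intro h
    apply hz'
    rw [mem_singleton_iff]
    exact ((extChartAt (𝓡 m) x₀).right_inv hz).symm.trans (congrArg _ h.symm)
  exact nonneg_of_mul_nonneg_left ((abs_nonneg _).trans (hρL x₀ _)) hd

end Density

/-! ### Degrees as empirical masses of balls, and transport -/

section Degrees

variable {M : Type*} {n : ℕ}

lemma real_empiricalMeasure [MeasurableSpace M] (x : Fin n → M) {A : Set M} (hA : MeasurableSet A) :
    (empiricalMeasure x).real A = (n : ℝ)⁻¹ * ∑ i, A.indicator (fun _ => (1 : ℝ)) (x i) := by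
  classical
  rw [Measure.real, empiricalMeasure, Measure.smul_apply, Measure.finsetSum_apply, smul_eq_mul,
    ENNReal.toReal_mul, ENNReal.toReal_sum (fun i _ => measure_ne_top _ _)]
  congr 1
  · simp
  · refine Finset.sum_congr rfl fun i _ => ?_
    rw [Measure.dirac_apply' _ hA]
    by_cases h : x i ∈ A <;> simp [h]

lemma kernelEta_dist [MetricSpace M] {h : ℝ} (hh : 0 < h) (m : ℕ) (x y : M) :
    kernelEta m (dist x y / h) =
      1 / unitBallVolume m * (Metric.closedBall x h).indicator (fun _ => (1 : ℝ)) y := by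
  have h1 : dist x y / h ∈ Icc (0 : ℝ) 1 ↔ y ∈ Metric.closedBall x h := by
    rw [mem_Icc, div_le_one hh, Metric.mem_closedBall']
    exact and_iff_right (by positivity)
  by_cases hy : y ∈ Metric.closedBall x h
  · rw [kernelEta, indicator_of_mem (h1.2 hy), indicator_of_mem hy, mul_one]
  · rw [kernelEta, indicator_of_notMem (fun h' => hy (h1.1 h')), indicator_of_notMem hy, mul_zero]

variable [MetricSpace M] [MeasurableSpace M] [BorelSpace M]

lemma sum_kernelEta_cloudDist {h : ℝ} (hh : 0 < h) (m : ℕ) (x : Fin n → M) (i : Fin n) :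
    ∑ j, kernelEta m (cloudDist x i j / h) =
      n / unitBallVolume m * (empiricalMeasure x).real (Metric.closedBall (x i) h) := by
  have hn : (n : ℝ) ≠ 0 := by exact_mod_cast i.pos.ne'
  simp only [cloudDist, kernelEta_dist hh]
  rw [real_empiricalMeasure x Metric.isClosed_closedBall.measurableSet, ← Finset.mul_sum]
  field_simp

lemma unitBallVolume_pos (m : ℕ) : 0 < unitBallVolume m :=
  ENNReal.toReal_pos (Metric.measure_ball_pos _ _ one_pos).ne' measure_ball_lt_top.ne

lemma kernelEta_nonneg (m : ℕ) (t : ℝ) : 0 ≤ kernelEta m t :=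
  indicator_nonneg (fun _ _ => (one_div_pos.2 (unitBallVolume_pos m)).le) t

lemma sum_kernelEta_pos (m : ℕ) {d : Fin n → Fin n → ℝ} (hd : ∀ i, d i i = 0) (h : ℝ) (i : Fin n) :
    0 < ∑ j, kernelEta m (d i j / h) := by
  refine Finset.sum_pos' (fun j _ => kernelEta_nonneg m _) ⟨i, Finset.mem_univ i, ?_⟩
  rw [hd, zero_div, kernelEta, indicator_of_mem (by simp)]
  exact one_div_pos.2 (unitBallVolume_pos m)

-- Compactness makes the essential supremum finite, so `toReal` does not fall back to its default
-- value `0`.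
omit [BorelSpace M] in
lemma ae_dist_le_transportDist [CompactSpace M] (ν : Measure M) (T : M → M) :
    ∀ᵐ y ∂ν, dist y (T y) ≤ transportDist ν T := by
  have hfin : essSup (fun x => edist x (T x)) ν ≠ ⊤ := by
    refine ne_top_of_le_ne_top (ENNReal.ofReal_ne_top (r := Metric.diam (univ : Set M)))
      (essSup_le_of_ae_le _ (Filter.Eventually.of_forall fun x => ?_))
    change edist x (T x) ≤ _
    rw [edist_dist]
    exact ENNReal.ofReal_le_ofReal
      (Metric.dist_le_diam_of_mem isCompact_univ.isBounded (mem_univ _) (mem_univ _))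
  filter_upwards [ae_le_essSup (μ := ν) (f := fun x => edist x (T x))] with y hy
  rw [dist_edist]
  exact ENNReal.toReal_mono hfin hy

lemma real_map_closedBall_le {ν ν' : Measure M} [IsFiniteMeasure ν] {T : M → M}
    (hT : IsTransportMap ν ν' T) {d : ℝ} (hd : ∀ᵐ y ∂ν, dist y (T y) ≤ d) (x : M) (r : ℝ) :
    ν'.real (Metric.closedBall x r) ≤ ν.real (Metric.closedBall x (r + d)) := by
  rw [← hT.2, map_measureReal_apply hT.1 Metric.isClosed_closedBall.measurableSet]
  refine ENNReal.toReal_mono (measure_ne_top _ _) (measure_mono_ae ?_)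
  filter_upwards [hd] with y hy hyT
  have h1 : dist (T y) x ≤ r := hyT
  have h2 : dist y x ≤ r + d := by linarith [dist_triangle y (T y) x]
  exact h2

lemma real_closedBall_le_map {ν ν' : Measure M} [IsFiniteMeasure ν] {T : M → M}
    (hT : IsTransportMap ν ν' T) {d : ℝ} (hd : ∀ᵐ y ∂ν, dist y (T y) ≤ d) (x : M) (r : ℝ) :
    ν.real (Metric.closedBall x (r - d)) ≤ ν'.real (Metric.closedBall x r) := by
  rw [← hT.2, map_measureReal_apply hT.1 Metric.isClosed_closedBall.measurableSet]
  refine ENNReal.toReal_mono (measure_ne_top _ _) (measure_mono_ae ?_)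
  filter_upwards [hd] with y hy hyx
  have h1 : dist y x ≤ r - d := hyx
  have h2 : dist (T y) x ≤ r := by linarith [dist_triangle_left (T y) x y]
  exact h2

end Degrees

/-! ### Spectra of nested proximity graphs -/

section Spectrum

variable {n : ℕ}

/-- Comparison of the eigenvalues of the random-walk Laplacians of two nested proximity graphs. -/
lemma kthEigenvalue_rwLaplacian_le (m : ℕ) {d₁ d₂ : Fin n → Fin n → ℝ}
    (hd₁ : IsDistanceFunction d₁) (hd₂ : IsDistanceFunction d₂) {h₁ h₂ : ℝ} (hh₁ : 0 < h₁)
    (hh₂ : 0 < h₂) (hle : ∀ i j, kernelEta m (d₁ i j / h₁) ≤ kernelEta m (d₂ i j / h₂)) {t : ℝ}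
    (hD : ∀ i, ∑ j, kernelEta m (d₂ i j / h₂) ≤ t * ∑ j, kernelEta m (d₁ i j / h₁))
    {k : ℕ} (hk : 1 ≤ k) (hkn : k ≤ n) :
    0 ≤ kthEigenvalue (rwLaplacian m d₂ h₂) k ∧
      kthEigenvalue (rwLaplacian m d₁ h₁) k ≤
        t * (h₂ ^ 2 / h₁ ^ 2) * kthEigenvalue (rwLaplacian m d₂ h₂) k := by
  have hp₁ := sum_kernelEta_pos m hd₁.self_eq_zero h₁
  have hp₂ := sum_kernelEta_pos m hd₂.self_eq_zero h₂
  have h := kthEigenvalue_le (by positivity) (by positivity)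
    (fun i j => by simp only [hd₁.symm i j])
    (fun i j => by simp only [hd₂.symm i j]) hp₁ hp₂
    (toMatrix_rwLaplacian m d₁ hh₁ hp₁) (toMatrix_rwLaplacian m d₂ hh₂ hp₂)
    (fun i j => kernelEta_nonneg m _) hle hD hk hkn
  have e : (2 * ((m : ℝ) + 2) / h₁ ^ 2) / (2 * (m + 2) / h₂ ^ 2) = h₂ ^ 2 / h₁ ^ 2 := by
    field_simp
  rwa [e] at h

end Spectrum

/-! ### Comparison of inner and outer degrees -/

section MainEstimate

/-- Linearizes the quotient: `(1 + σ) / (1 - σ) ≤ 1 + 3 σ`, likewise for `q`, and the cross term `9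
σ q` fits into `2 σ`. -/
lemma le_one_add_mul_of_mul_le {A B σ q : ℝ} (hσ : 0 ≤ σ) (hσ' : σ ≤ 1 / 8) (hq : 0 ≤ q)
    (hq' : q ≤ 1 / 8) (hB : 0 ≤ B) (h : (1 - σ) * (1 - q) * A ≤ (1 + σ) * (1 + q) * B) :
    A ≤ (1 + 5 * σ + 3 * q) * B := by
  have h1 : 1 + σ ≤ (1 - σ) * (1 + 3 * σ) := by nlinarith
  have h2 : 1 + q ≤ (1 - q) * (1 + 3 * q) := by nlinarith
  have h3 : (1 + 3 * σ) * (1 + 3 * q) ≤ 1 + 5 * σ + 3 * q := by nlinarith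
  have h4 : (0 : ℝ) < (1 - σ) * (1 - q) := mul_pos (by linarith) (by linarith)
  refine le_of_mul_le_mul_left (h.trans ?_) h4
  calc (1 + σ) * (1 + q) * B ≤ ((1 - σ) * (1 + 3 * σ)) * ((1 - q) * (1 + 3 * q)) * B := by
        gcongr
        linarith
    _ = (1 - σ) * (1 - q) * ((1 + 3 * σ) * (1 + 3 * q) * B) := by ring
    _ ≤ (1 - σ) * (1 - q) * ((1 + 5 * σ + 3 * q) * B) := by gcongr

variable {m : ℕ} {M : Type*} [MetricSpace M] [ChartedSpace (EuclideanSpace ℝ (Fin m)) M]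
  [RiemannianBundle (fun x : M => TangentSpace (𝓡 m) x)] [MeasurableSpace M] [BorelSpace M]

/-- The degrees in the proximity graphs of radii `h (1 + δ)` and `h (1 - δ)` are comparable. -/
lemma sum_kernelEta_le_mul {ρ : M → ℝ} {β L : ℝ} (hm : 1 ≤ m) (hβ : 0 < β) (hL : 0 ≤ L)
    (hρ : ∀ x, 1 / β ≤ ρ x) (hρL : ∀ x y, |ρ x - ρ y| ≤ L * dist x y)
    [IsProbabilityMeasure (densityMeasure m ρ)] {R : ℝ}
    (hvol : ∀ (x : M) (s t : ℝ), 0 ≤ s → s < 1 → 0 ≤ t → t < R →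
      ENNReal.ofReal ((1 - s) ^ m) * riemannianVolume m M (Metric.closedBall x t) ≤
      ENNReal.ofReal (1 + s) * riemannianVolume m M (Metric.closedBall x ((1 - s / 2) * t)))
    {n : ℕ} {x : Fin n → M} {T : M → M}
    (hT : IsTransportMap (densityMeasure m ρ) (empiricalMeasure x) T) {d : ℝ} (hd0 : 0 ≤ d)
    (hd : ∀ᵐ y ∂(densityMeasure m ρ), dist y (T y) ≤ d) {h δ : ℝ} (hh : 0 < h) (hδ : 0 ≤ δ)
    (hhR : 2 * h < R) (hq : β * L * h ≤ 1 / 16) (hmδ : m * δ ≤ 1 / 64)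
    (hmd : m * (d / h) ≤ 1 / 64) (i : Fin n) :
    ∑ j, kernelEta m (cloudDist x i j / (h * (1 + δ))) ≤
      (1 + 20 * (m * δ) + 20 * (m * (d / h)) + 6 * (β * L * h)) *
        ∑ j, kernelEta m (cloudDist x i j / (h * (1 - δ))) := by
  have hm1 : (1 : ℝ) ≤ m := by exact_mod_cast hm
  have hdh : 0 ≤ d / h := by positivity
  have hδm : δ ≤ m * δ := le_mul_of_one_le_left hδ hm1
  have hdm : d / h ≤ m * (d / h) := le_mul_of_one_le_left hdh hm1
  -- `t` is the outer radius enlarged by the transport distance. It exceeds `h (1 - δ) - d` by `2 (h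
  -- δ + d)`, which equals `s / 2 * h`; as `t ≥ h`, contraction by `1 - s / 2` closes the gap.
  set t := h * (1 + δ) + d with ht
  set s := 4 * (δ + d / h) with hs
  have hhd : h * (d / h) = d := by field_simp
  have ht' : t = h * (1 + δ + d / h) := by rw [ht, mul_add h (1 + δ), hhd]
  have ht0 : 0 ≤ t := by rw [ht']; positivity
  have ht2 : t ≤ 2 * h := by rw [ht', mul_comm]; gcongr; linarith
  have hs0 : 0 ≤ s := by positivity
  have hms : m * s = 4 * (m * δ) + 4 * (m * (d / h)) := by rw [hs]; ring
  have hms0 : 0 ≤ m * s := by positivity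
  have hms8 : m * s ≤ 1 / 8 := by rw [hms]; linarith
  have hsm : s ≤ m * s := le_mul_of_one_le_left hs0 hm1
  have hq2 : β * L * t ≤ 2 * (β * L * h) := by
    calc β * L * t ≤ β * L * (2 * h) := by gcongr
      _ = _ := by ring
  have hq0 : 0 ≤ β * L * t := by positivity
  have hball := real_densityMeasure_closedBall_le hβ hL hρ hρL hs0 (by linarith) ht0 (by linarith)
    (hvol (x i) s t hs0 (by linarith) ht0 (by linarith))
  set ν := densityMeasure m ρ
  have hr : (1 - s / 2) * t ≤ h * (1 - δ) - d := by
    have h1 : s / 2 * h = 2 * (h * δ + d) := by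
      calc s / 2 * h = 2 * (h * δ + h * (d / h)) := by rw [hs]; ring
        _ = _ := by rw [hhd]
    have h2 : s / 2 * h ≤ s / 2 * t := by
      gcongr
      rw [ht]
      nlinarith [mul_nonneg hh.le hδ]
    rw [ht] at h2 ⊢
    linarith
  -- Bernoulli's inequality; the errors become linear in `m`.
  have hpow : 1 - m * s ≤ (1 - s) ^ m := by
    have := one_add_mul_le_pow (a := -s) (by linarith) m
    rw [← sub_eq_add_neg] at this
    linarith
  have hmono : ν.real (Metric.closedBall (x i) ((1 - s / 2) * t)) ≤
      ν.real (Metric.closedBall (x i) (h * (1 - δ) - d)) :=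
    measureReal_mono (Metric.closedBall_subset_closedBall hr)
  set A := (empiricalMeasure x).real (Metric.closedBall (x i) (h * (1 + δ)))
  set B := (empiricalMeasure x).real (Metric.closedBall (x i) (h * (1 - δ)))
  have hA : A ≤ ν.real (Metric.closedBall (x i) t) := real_map_closedBall_le hT hd _ _
  have hB : ν.real (Metric.closedBall (x i) (h * (1 - δ) - d)) ≤ B :=
    real_closedBall_le_map hT hd _ _
  have hB0 : 0 ≤ B := measureReal_nonneg
  have hA0 : 0 ≤ A := measureReal_nonneg
  have hAB : A ≤ (1 + 5 * (m * s) + 3 * (β * L * t)) * B := by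
    refine le_one_add_mul_of_mul_le hms0 hms8 hq0 (by linarith) hB0 ?_
    calc (1 - m * s) * (1 - β * L * t) * A
        ≤ (1 - s) ^ m * (1 - β * L * t) * ν.real (Metric.closedBall (x i) t) := by
          gcongr
          · exact mul_nonneg (pow_nonneg (by linarith) _) (by linarith)
          · linarith
      _ ≤ (1 + s) * (1 + β * L * t) * ν.real (Metric.closedBall (x i) ((1 - s / 2) * t)) := hball
      _ ≤ (1 + m * s) * (1 + β * L * t) * B := by
          gcongr
          exact hmono.trans hB
  rw [sum_kernelEta_cloudDist (by positivity), sum_kernelEta_cloudDist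
    (mul_pos hh (by linarith)), mul_left_comm]
  have hω := unitBallVolume_pos m
  gcongr
  exact hAB.trans (mul_le_mul_of_nonneg_right (by linarith) hB0)

end MainEstimate

/-! ### Assembly of the eigenvalue bounds -/

theorem theorem5p4 :
    -- `C`, `c` are absolute constants
    ∃ C > (0 : ℝ), ∃ c > (0 : ℝ),
    ∀ (m : ℕ) (_ : 1 ≤ m) (β L₁ : ℝ) (_ : 0 < β),
    -- `C₁`, `C₂` depend on `m`, `β`, `L₁` only
    ∃ C₁ > (0 : ℝ), ∃ C₂ > (0 : ℝ),
    -- `M` is a compact connected smooth Riemannian manifold of dimension `m`,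
    -- and `dist` is its geodesic distance
    ∀ (M : Type*) [MetricSpace M] [ChartedSpace (EuclideanSpace ℝ (Fin m)) M]
      [IsManifold (𝓡 m) ∞ M]
      [RiemannianBundle (fun x : M => TangentSpace (𝓡 m) x)]
      [IsContMDiffRiemannianBundle (𝓡 m) ∞ (EuclideanSpace ℝ (Fin m))
        (fun x : M => TangentSpace (𝓡 m) x)]
      [IsRiemannianManifold (𝓡 m) M] [CompactSpace M] [ConnectedSpace M]
      [MeasurableSpace M] [BorelSpace M],
    ∃ h₀ > (0 : ℝ),
    -- `ν = ρ dVol` is a probability measure with a smooth density `ρ`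
    ∀ (ρ : M → ℝ) (_ : ContMDiff (𝓡 m) 𝓘(ℝ) ∞ ρ)
      (_ : ∀ x, 1 / β ≤ ρ x ∧ ρ x ≤ β)
      (_ : ∀ x y, |ρ x - ρ y| ≤ L₁ * dist x y)
      (_ : IsProbabilityMeasure (densityMeasure m ρ))
      -- `X 0, …, X (n-1)` is an i.i.d. sample from `ν`
      (n : ℕ) (Ω : Type*) [MeasurableSpace Ω] (P : Measure Ω) [IsProbabilityMeasure P]
      (X : Fin n → Ω → M) (_ : ∀ i, Measurable (X i)) (_ : iIndepFun X P)
      (_ : ∀ i, P.map (X i) = densityMeasure m ρ)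
      -- `d0 w` is a distance function on the sample
      (d0 : Ω → Fin n → Fin n → ℝ) (_ : ∀ w, IsDistanceFunction (d0 w))
      (h δ : ℝ) (_ : 0 < h) (_ : h ≤ h₀) (_ : 0 ≤ δ) (_ : m * δ ≤ c) (ε : ℝ≥0)
      -- the kernel sandwich holds with probability at least `1 - ε`
      (_ : P {w | ¬ KernelSandwich m (cloudDist fun i => X i w) (d0 w) h δ} ≤ ε),
    -- with probability at least `1 - ε` both eigenvalue bounds hold
    P {w | ¬ ∀ T : M → M,
        IsTransportMap (densityMeasure m ρ) (empiricalMeasure fun i => X i w) T →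
        m * transportDist (densityMeasure m ρ) T ≤ c * h →
        ∀ k : ℕ, 1 ≤ k → k ≤ n →
          kthEigenvalue (rwLaplacian m (d0 w) h) k ≤
            (1 + (C * m * δ + C * β * L₁ * h
                + C * m * β ^ 2 * (transportDist (densityMeasure m ρ) T / h)
                + C₁ * h ^ 2 + C₂ * δ * h)) *
              kthEigenvalue (rwLaplacian m (cloudDist fun i => X i w) (h * (1 + δ))) k ∧
          (1 - (C * m * δ + C * β * L₁ * h
                + C * m * β ^ 2 * (transportDist (densityMeasure m ρ) T / h)
                + C₁ * h ^ 2 + C₂ * δ * h)) *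
              kthEigenvalue (rwLaplacian m (cloudDist fun i => X i w) (h * (1 - δ))) k ≤
            kthEigenvalue (rwLaplacian m (d0 w) h) k} ≤ ε := by
  -- The terms with `C₁` and `C₂` are pure slack, discarded below as nonnegative, so `1` serves for
  -- both.
  refine ⟨100, by norm_num, 1 / 64, by norm_num, fun m hm β L₁ hβ =>
    ⟨1, one_pos, 1, one_pos, ?_⟩⟩
  intro M _ _ _ _ _ _ _ _ _ _
  obtain ⟨R, hR, hvol⟩ := exists_forall_mul_volume_closedBall_le m M
  -- The first bound keeps `2 h` below `R`, the second gives `β L₁ h ≤ 1 / 16`. The sign of `L₁` is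
  -- not yet known here, hence the absolute value.
  refine ⟨min (R / 4) (1 / (16 * (β * |L₁| + 1))), by positivity, ?_⟩
  intro ρ _ hρ hρL hprob n Ω _ P _ X _ _ _ d0 hd0 h δ hh hh0 hδ hmδ ε hε
  refine (measure_mono (fun w hw => ?_)).trans hε
  intro hsand
  refine hw ?_
  intro T hT hmd k hk hkn
  set x : Fin n → M := fun i => X i w
  have hne : Nonempty M := ⟨x ⟨0, by omega⟩⟩
  have hL : 0 ≤ L₁ := lipschitz_const_nonneg hm hρL
  set ν := densityMeasure m ρ
  set d := transportDist ν T with hd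
  have hd0' : 0 ≤ d := ENNReal.toReal_nonneg
  have hm1 : (1 : ℝ) ≤ m := by exact_mod_cast hm
  have hq : β * L₁ * h ≤ 1 / 16 := by
    have h1 := hh0.trans (min_le_right _ _)
    rw [abs_of_nonneg hL, le_div_iff₀ (by positivity)] at h1
    linarith
  have hmd' : m * (d / h) ≤ 1 / 64 := by
    rw [← mul_div_assoc, div_le_iff₀ hh]
    exact hmd
  have hβ1 : 1 ≤ β ^ 2 := by
    obtain ⟨y⟩ := hne
    have := (hρ y).1.trans (hρ y).2
    rw [div_le_iff₀ hβ] at this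
    linarith [sq β]
  have hδm : δ ≤ m * δ := le_mul_of_one_le_left hδ hm1
  have hhR : 2 * h < R := by linarith [hh0.trans (min_le_left _ _)]
  have hdeg := sum_kernelEta_le_mul hm hβ hL (fun y => (hρ y).1) hρL hvol hT hd0'
    (ae_dist_le_transportDist ν T) hh hδ hhR hq hmδ hmd'
  set a := m * δ
  set b := m * (d / h)
  set q := β * L₁ * h
  have ha0 : 0 ≤ a := by positivity
  have hb0 : 0 ≤ b := by positivity
  have hq0 : 0 ≤ q := by positivity
  set K := 1 + 20 * a + 20 * b + 6 * q with hK
  have hK0 : 0 ≤ K := by positivity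
  set E := 100 * m * δ + 100 * β * L₁ * h + 100 * m * β ^ 2 * (d / h) + 1 * h ^ 2 + 1 * δ * h
    with hE
  have hEge : 100 * a + 100 * b + 100 * q ≤ E := by
    have h1 : b ≤ β ^ 2 * b := le_mul_of_one_le_left hb0 hβ1
    have h2 : E = 100 * a + 100 * (β ^ 2 * b) + 100 * q + h ^ 2 + δ * h := by
      rw [hE]
      ring
    rw [h2]
    nlinarith [sq_nonneg h, mul_nonneg hδ hh.le]
  clear_value E
  -- The factor `1 + 3 δ` bounds both bandwidth ratios, `(1 + δ)²` and `(1 - δ)⁻²`.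
  have hKE : (1 + 3 * δ) * K ≤ 1 + E := by
    have h1 : δ * K ≤ a * 2 := mul_le_mul hδm (by rw [hK]; linarith) hK0 ha0
    linarith
  have hcloud : IsDistanceFunction (cloudDist x) :=
    ⟨fun _ _ => dist_nonneg, fun _ => dist_self _, fun _ _ => dist_comm _ _⟩
  have hp : 0 < h * (1 + δ) := by positivity
  have hn : 0 < h * (1 - δ) := mul_pos hh (by linarith)
  constructor
  -- The degrees of the `d0` graph lie between the inner and outer ones, so `K` also bounds the
  -- degree ratio of neighbouring graphs.
  · obtain ⟨h0, h1⟩ := kthEigenvalue_rwLaplacian_le m (hd0 w) hcloud hh hp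
      (fun i j => (hsand i j).2) (t := K) (fun i => (hdeg i).trans (by
        gcongr with j
        exact (hsand i j).1)) hk hkn
    refine h1.trans (mul_le_mul_of_nonneg_right ?_ h0)
    have h2 : (h * (1 + δ)) ^ 2 / h ^ 2 = (1 + δ) ^ 2 := by field_simp
    rw [h2]
    refine le_trans ?_ hKE
    rw [mul_comm]
    gcongr
    nlinarith
  · obtain ⟨h0, h1⟩ := kthEigenvalue_rwLaplacian_le m hcloud (hd0 w) hn hh
      (fun i j => (hsand i j).1) (t := K) (fun i => le_trans (by
        gcongr with j
        exact (hsand i j).2) (hdeg i)) hk hkn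
    obtain ⟨h0', -⟩ := kthEigenvalue_rwLaplacian_le m hcloud hcloud hn hn
      (fun i j => le_rfl) (t := 1) (fun i => (one_mul _).ge) hk hkn
    have h2 : h ^ 2 / (h * (1 - δ)) ^ 2 ≤ 1 + 3 * δ := by
      rw [mul_pow, div_le_iff₀ (by have : 0 < 1 - δ := by linarith
                                   positivity)]
      have : 1 ≤ (1 + 3 * δ) * (1 - δ) ^ 2 := by
        nlinarith [mul_nonneg hδ (show (0 : ℝ) ≤ 1 - 5 * δ by linarith), pow_nonneg hδ 3]
      nlinarith [sq_nonneg h]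
    have hE0 : 0 ≤ E := by linarith
    have h3 : kthEigenvalue (rwLaplacian m (cloudDist x) (h * (1 - δ))) k ≤
        (1 + E) * kthEigenvalue (rwLaplacian m (d0 w) h) k := by
      refine h1.trans (mul_le_mul_of_nonneg_right (le_trans ?_ hKE) h0)
      rw [mul_comm]
      gcongr
    -- If `E ≥ 1`, the left side is nonpositive; otherwise `(1 - E) (1 + E) ≤ 1` inverts the factor
    -- `1 + E`.
    rcases le_total (1 - E) 0 with h4 | h4
    · exact (mul_nonpos_of_nonpos_of_nonneg h4 h0').trans h0
    · refine (mul_le_mul_of_nonneg_left h3 h4).trans ?_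
      rw [← mul_assoc]
      have h5 : (1 - E) * (1 + E) = 1 - E ^ 2 := by ring
      exact mul_le_of_le_one_left h0 (by rw [h5]; linarith [sq_nonneg E])
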